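/- Let $\mathbb H^2\times\mathbb R=\{(x,y,z)\in\mathbb R^3: y>0\}$ carry the product metric $g=\frac{dx^2+dy^2}{y^2}+dz^2$, with Levi-Civita connection $\nabla$ and curvature tensor $R$. A homogeneous structure tensor is a smooth $(1,2)$-tensor field $S$ such that $\tilde\nabla=\nabla-S$ satisfies $\tilde\nabla g=0$, $\tilde\nabla R=0$, $\tilde\nabla S=0$; it is identified with the $(0,3)$-tensor $S(X,Y,Z)=g(S_XY,Z)$. Two such tensors $S,S'$ are isomorphic if $\phi_*(S_XY)=S'_{\phi_*X}\phi_*Y$ for some isometry $\phi$ of $(\mathbb H^2\times\mathbb R,g)$. Put $\theta^1=dx/y$, $\theta^2=dy/y$, $\theta^3=dz$, $dV=\theta^1\wedge\theta^2=\theta^1\otimes\theta^2-\theta^2\otimes\theta^1$, and $$T^\lambda=\lambda\,\theta^3\otimes dV\quad(\lambda\in\mathbb R),\qquad T=\theta^1\otimes dV .$$ (1) $T^\lambda$ ($\lambda\ge 0$) and $T$ are homogeneous structure tensors, every homogeneous structure tensor on $\mathbb H^2\times\mathbb R$ is isomorphic to $T$ or to some $T^\lambda$ with $\lambda\ge0$,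 and no two distinct tensors among $T$ and the $T^\lambda$, $\lambda\ge 0$, are isomorphic. (2) For a group $G$ acting transitively by isometries with isotropy group $H$ at the origin $o=(0,1,0)$ and Lie algebras $\mathfrak h\subset\mathfrak g$, and for a linear complement $\mathfrak m$ of $\mathfrak h$ in $\mathfrak g$ with $\mathrm{Ad}(H)\mathfrak m\subset\mathfrak m$, the tensor determined by $\mathfrak g=\mathfrak m\oplus\mathfrak h$ is the $G$-invariant $(1,2)$-tensor field $S$ with $\big((\nabla-S)_{X^*}Y^*\big)_o=-([X,Y]_{\mathfrak m})^*_o$ for all $X,Y\in\mathfrak m$, where $X^*_p=\frac{d}{dt}\exp(tX)\cdot p\,|_{t=0}$. The group $\mathrm{SL}(2,\mathbb R)\times\mathbb R$ acts transitively by isometries, by $\left(\begin{pmatrix}a&b\\c&d\end{pmatrix},s\right)\cdot(w,z)=\left(\frac{aw+b}{cw+d},z+s\right)$ with $w=x+iy$, and its isotropy group at $o$ is $\mathrm{SO}(2)$; the tensors determined by the corresponding reductive decompositions are exactly the $T^\lambda$, $\lambda\in\mathbb R$. The solvable Lie group of the matrices $\begin{pmatrix}y&x&0\\0&1&0\\0&0&e^z\end{pmatrix}$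 ($y>0$), identified with $\mathbb H^2\times\mathbb R$, acts on it simply transitively by isometries by left multiplication (so $g$ is left-invariant); the only tensor determined by the corresponding reductive decomposition (with $\mathfrak h=0$) is $T$. -/

import Mathlib

open Set Matrix
open scoped ContDiff

noncomputable section

/-! ### Riemannian geometry on an open subset of `ℝⁿ` (a manifold with one global chart) -/

/-- Points of the coordinate space `ℝⁿ`, and also tangent vectors in the coordinate frame. -/
abbrev Vec (n : ℕ) := Fin n → ℝ

/-- Fields of `(1,2)`-tensors: `T p X Y` is the tangent vector `T_X Y` at `p`. -/
abbrev Tensor12 (n : ℕ) := Vec n → Vec n →ₗ[ℝ] Vec n →ₗ[ℝ] Vec n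

/-- Fields of `(0,3)`-tensors. -/
abbrev Tensor03 (n : ℕ) := Vec n → Vec n →ₗ[ℝ] Vec n →ₗ[ℝ] Vec n →ₗ[ℝ] ℝ

/-- The scalar product `g_p(X,Y)`, where `g p` is the matrix `(g_{ij}(p))`. -/
def metricAt {n : ℕ} (g : Vec n → Matrix (Fin n) (Fin n) ℝ) (p X Y : Vec n) : ℝ :=
  X ⬝ᵥ (g p *ᵥ Y)

/-- Raising an index: the tangent vector at `p` that is `g`-dual to the covector `ξ`. -/
def sharp {n : ℕ} (g : Vec n → Matrix (Fin n) (Fin n) ℝ) (p : Vec n) :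
    (Vec n →ₗ[ℝ] ℝ) →ₗ[ℝ] Vec n where
  toFun ξ := (g p)⁻¹ *ᵥ fun l => ξ (Pi.single l 1)
  map_add' ξ η := by rw [← Matrix.mulVec_add]; rfl
  map_smul' c ξ := by rw [RingHom.id_apply, ← Matrix.mulVec_smul]; rfl

/-- The `(1,2)`-tensor field `T` with `g(T_X Y, Z) = τ(X,Y,Z)`. -/
def raiseIndex {n : ℕ} (g : Vec n → Matrix (Fin n) (Fin n) ℝ) (τ : Tensor03 n) : Tensor12 n :=
  fun p => (τ p).compr₂ (sharp g p)

/-- The Christoffel symbols of the Levi-Civita connection of `g`, as a bilinear expression: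
`Γ(X,Y)^k = ½ g^{kl} (∂_X g(Y,e_l) + ∂_Y g(X,e_l) - ∂_l g(X,Y))` for constant `X`, `Y`.
So `∇_X Y = D_X Y + Γ(X,Y)`. -/
def christoffel {n : ℕ} (g : Vec n → Matrix (Fin n) (Fin n) ℝ) (p X Y : Vec n) : Vec n :=
  (g p)⁻¹ *ᵥ fun l => (1 / 2 : ℝ) *
    (fderiv ℝ (fun q => metricAt g q Y (Pi.single l 1)) p X
      + fderiv ℝ (fun q => metricAt g q X (Pi.single l 1)) p Y
      - fderiv ℝ (fun q => metricAt g q X Y) p (Pi.single l 1))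

/-- The curvature tensor `R(X,Y)Z` of the Levi-Civita connection, in coordinates. -/
def curvature {n : ℕ} (g : Vec n → Matrix (Fin n) (Fin n) ℝ) (p X Y Z : Vec n) : Vec n :=
  fderiv ℝ (fun q => christoffel g q Y Z) p X - fderiv ℝ (fun q => christoffel g q X Z) p Y
    + christoffel g p X (christoffel g p Y Z) - christoffel g p Y (christoffel g p X Z)

/-- The connection coefficients of `∇̃ = ∇ - T`, that is, `∇̃_X Y = D_X Y + Γ(X,Y) - T_X Y`. -/
def tildeCoeff {n : ℕ} (g : Vec n → Matrix (Fin n) (Fin n) ℝ) (T : Tensor12 n)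
    (p X Y : Vec n) : Vec n :=
  christoffel g p X Y - T p X Y

/-- The covariant derivative `∇̃_X Y` of a vector field `Y` at `p`, for a tangent vector `X`. -/
def tildeNabla {n : ℕ} (g : Vec n → Matrix (Fin n) (Fin n) ℝ) (T : Tensor12 n)
    (p X : Vec n) (Y : Vec n → Vec n) : Vec n :=
  fderiv ℝ Y p X + tildeCoeff g T p X (Y p)

/-- `T` is a homogeneous structure tensor on the open set `U` with metric `g`: a smooth
`(1,2)`-tensor field with `∇̃g = 0`, `∇̃R = 0` and `∇̃T = 0`, where `∇̃ = ∇ - T` and `∇`, `R` are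
the Levi-Civita connection of `g` and its curvature. The three covariant derivatives are written
in coordinates, that is, on constant vector fields. -/
structure IsHomogeneousStructure {n : ℕ} (U : Set (Vec n))
    (g : Vec n → Matrix (Fin n) (Fin n) ℝ) (T : Tensor12 n) : Prop where
  smooth : ∀ X Y : Vec n, ContDiffOn ℝ ∞ (fun p => T p X Y) U
  nabla_metric : ∀ p ∈ U, ∀ W X Y : Vec n,
    fderiv ℝ (fun q => metricAt g q X Y) p W
      - metricAt g p (tildeCoeff g T p W X) Y - metricAt g p X (tildeCoeff g T p W Y) = 0
  nabla_curvature : ∀ p ∈ U, ∀ W X Y Z : Vec n,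
    fderiv ℝ (fun q => curvature g q X Y Z) p W + tildeCoeff g T p W (curvature g p X Y Z)
      - curvature g p (tildeCoeff g T p W X) Y Z - curvature g p X (tildeCoeff g T p W Y) Z
      - curvature g p X Y (tildeCoeff g T p W Z) = 0
  nabla_tensor : ∀ p ∈ U, ∀ W X Y : Vec n,
    fderiv ℝ (fun q => T q X Y) p W + tildeCoeff g T p W (T p X Y)
      - T p (tildeCoeff g T p W X) Y - T p X (tildeCoeff g T p W Y) = 0

/-- `φ` is an isometry of `(U,g)`: a diffeomorphism of `U` onto itself with `φ^* g = g`. -/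
structure IsRiemannianIsometry {n : ℕ} (U : Set (Vec n))
    (g : Vec n → Matrix (Fin n) (Fin n) ℝ) (φ : Vec n → Vec n) : Prop where
  smooth : ContDiffOn ℝ ∞ φ U
  mapsTo : MapsTo φ U U
  exists_inverse : ∃ ψ : Vec n → Vec n, ContDiffOn ℝ ∞ ψ U ∧ MapsTo ψ U U ∧ InvOn ψ φ U U
  metric : ∀ p ∈ U, ∀ X Y : Vec n,
    metricAt g (φ p) (fderiv ℝ φ p X) (fderiv ℝ φ p Y) = metricAt g p X Y

/-- `φ_*(T_X Y) = T'_{φ_* X} φ_* Y` on `U`. -/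
def Intertwines {n : ℕ} (U : Set (Vec n)) (φ : Vec n → Vec n) (T T' : Tensor12 n) : Prop :=
  ∀ p ∈ U, ∀ X Y : Vec n,
    fderiv ℝ φ p (T p X Y) = T' (φ p) (fderiv ℝ φ p X) (fderiv ℝ φ p Y)

/-- Isomorphism of homogeneous structure tensors on `(U,g)`. -/
def IsomorphicTensors {n : ℕ} (U : Set (Vec n)) (g : Vec n → Matrix (Fin n) (Fin n) ℝ)
    (T T' : Tensor12 n) : Prop :=
  ∃ φ : Vec n → Vec n, IsRiemannianIsometry U g φ ∧ Intertwines U φ T T'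

/-! ### Reductive decompositions of transitive matrix group actions -/

/-- The Lie algebra of a (closed) subgroup of `GL(m,ℝ)`, given by its set of elements. -/
def matrixLieAlgebra {m : ℕ} (G : Set (GL (Fin m) ℝ)) : Set (Matrix (Fin m) (Fin m) ℝ) :=
  {X | ∀ t : ℝ, ∃ A ∈ G, (A : Matrix (Fin m) (Fin m) ℝ) = NormedSpace.exp (t • X)}

/-- `act` restricts to a transitive action of the group `G` on `(U,g)` by isometries. -/
structure IsTransitiveIsometricAction {n m : ℕ} (U : Set (Vec n))
    (g : Vec n → Matrix (Fin n) (Fin n) ℝ) (G : Subgroup (GL (Fin m) ℝ))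
    (act : Matrix (Fin m) (Fin m) ℝ → Vec n → Vec n) : Prop where
  one_act : ∀ p ∈ U, act 1 p = p
  mul_act : ∀ A ∈ G, ∀ B ∈ G, ∀ p ∈ U, act (A * B : GL (Fin m) ℝ) p = act A (act B p)
  isometry : ∀ A ∈ G, IsRiemannianIsometry U g (act A)
  transitive : ∀ p ∈ U, ∀ q ∈ U, ∃ A ∈ G, act A p = q

/-- The isotropy group of `G` at `o`. -/
def isotropy {n m : ℕ} (G : Subgroup (GL (Fin m) ℝ))
    (act : Matrix (Fin m) (Fin m) ℝ → Vec n → Vec n) (o : Vec n) : Set (GL (Fin m) ℝ) :=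
  {A | A ∈ G ∧ act A o = o}

/-- The vector field `X^*_p = d/dt exp(tX)·p` at `t = 0`. -/
def fundamentalField {n m : ℕ} (act : Matrix (Fin m) (Fin m) ℝ → Vec n → Vec n)
    (X : Matrix (Fin m) (Fin m) ℝ) (p : Vec n) : Vec n :=
  deriv (fun t : ℝ => act (NormedSpace.exp (t • X)) p) 0

/-- `𝔪` is a Lie subspace: `𝔤 = 𝔪 ⊕ 𝔥` and `Ad(H) 𝔪 ⊆ 𝔪`, with `H` the isotropy group at `o`. -/
structure IsLieSubspace {n m : ℕ} (G : Subgroup (GL (Fin m) ℝ))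
    (act : Matrix (Fin m) (Fin m) ℝ → Vec n → Vec n) (o : Vec n)
    (𝔪 : Submodule ℝ (Matrix (Fin m) (Fin m) ℝ)) : Prop where
  subset : ∀ X ∈ 𝔪, X ∈ matrixLieAlgebra (G : Set (GL (Fin m) ℝ))
  span : ∀ X ∈ matrixLieAlgebra (G : Set (GL (Fin m) ℝ)),
    ∃ Y ∈ 𝔪, X - Y ∈ matrixLieAlgebra (isotropy G act o)
  disjoint : ∀ X ∈ 𝔪, X ∈ matrixLieAlgebra (isotropy G act o) → X = 0
  ad_invariant : ∀ A ∈ isotropy G act o, ∀ X ∈ 𝔪,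
    (A : Matrix (Fin m) (Fin m) ℝ) * X * ((A⁻¹ : GL (Fin m) ℝ) : Matrix (Fin m) (Fin m) ℝ) ∈ 𝔪

/-- `T` is the tensor `∇ - ∇̃` of the reductive decomposition `𝔤 = 𝔪 ⊕ 𝔥`: it is `G`-invariant and
`∇̃ = ∇ - T` satisfies `(∇̃_{X^*} Y^*)_o = -([X,Y]_𝔪)^*_o` for `X, Y ∈ 𝔪`. Here `W` is the
component `[X,Y]_𝔪`. -/
structure IsTensorOfLieSubspace {n m : ℕ} (U : Set (Vec n))
    (g : Vec n → Matrix (Fin n) (Fin n) ℝ) (G : Subgroup (GL (Fin m) ℝ))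
    (act : Matrix (Fin m) (Fin m) ℝ → Vec n → Vec n) (o : Vec n)
    (𝔪 : Submodule ℝ (Matrix (Fin m) (Fin m) ℝ)) (T : Tensor12 n) : Prop where
  invariant : ∀ A ∈ G, Intertwines U (act A) T T
  at_origin : ∀ X ∈ 𝔪, ∀ Y ∈ 𝔪, ∀ W ∈ 𝔪,
    (X * Y - Y * X) - W ∈ matrixLieAlgebra (isotropy G act o) →
      tildeNabla g T o (fundamentalField act X o) (fundamentalField act Y)
        = -fundamentalField act W o

/-- `T` arises from the coset space representation `G/H` of `(U,g)`. -/
def ArisesFromCosetSpace {n m : ℕ} (U : Set (Vec n))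
    (g : Vec n → Matrix (Fin n) (Fin n) ℝ) (G : Subgroup (GL (Fin m) ℝ))
    (act : Matrix (Fin m) (Fin m) ℝ → Vec n → Vec n) (o : Vec n) (T : Tensor12 n) : Prop :=
  ∃ 𝔪 : Submodule ℝ (Matrix (Fin m) (Fin m) ℝ),
    IsLieSubspace G act o 𝔪 ∧ IsTensorOfLieSubspace U g G act o 𝔪 T

/-! ### The Riemannian product `ℍ² × ℝ`, with coordinates `(x,y,z) = (p 0, p 1, p 2)` -/

/-- `ℍ² × ℝ` for the upper half plane model. -/
def H2R : Set (Vec 3) := {p | 0 < p 1}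

/-- The product metric `(dx² + dy²)/y² + dz²`. -/
def gH2R (p : Vec 3) : Matrix (Fin 3) (Fin 3) ℝ :=
  Matrix.diagonal ![1 / p 1 ^ 2, 1 / p 1 ^ 2, 1]

/-- The origin `(i,0)`. -/
def originH2R : Vec 3 := ![0, 1, 0]

/-- `θ¹ = dx/y`. -/
def theta1 (p : Vec 3) : Vec 3 →ₗ[ℝ] ℝ := (1 / p 1) • LinearMap.proj 0

/-- `θ² = dy/y`. -/
def theta2 (p : Vec 3) : Vec 3 →ₗ[ℝ] ℝ := (1 / p 1) • LinearMap.proj 1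

/-- `θ³ = dz`. -/
def theta3 (_p : Vec 3) : Vec 3 →ₗ[ℝ] ℝ := LinearMap.proj 2

/-- The area form `dV = θ¹ ∧ θ² = θ¹ ⊗ θ² - θ² ⊗ θ¹` of `ℍ²`. -/
def areaForm (p : Vec 3) : Vec 3 →ₗ[ℝ] Vec 3 →ₗ[ℝ] ℝ :=
  (theta1 p).smulRight (theta2 p) - (theta2 p).smulRight (theta1 p)

/-- `T^c = c dz ⊗ dV`, as a `(1,2)`-tensor. -/
def tensorFamily (c : ℝ) : Tensor12 3 :=
  raiseIndex gH2R fun p => c • (theta3 p).smulRight (areaForm p)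

/-- `T = θ¹ ⊗ dV`, as a `(1,2)`-tensor. -/
def tensorSolvable : Tensor12 3 :=
  raiseIndex gH2R fun p => (theta1 p).smulRight (areaForm p)

/-- The matrix `diag(B, e^t)`. -/
def blockMatrix (B : Matrix (Fin 2) (Fin 2) ℝ) (t : ℝ) : Matrix (Fin 3) (Fin 3) ℝ :=
  !![B 0 0, B 0 1, 0; B 1 0, B 1 1, 0; 0, 0, Real.exp t]

theorem blockMatrix_mul (B C : Matrix (Fin 2) (Fin 2) ℝ) (s t : ℝ) :
    blockMatrix B s * blockMatrix C t = blockMatrix (B * C) (s + t) := by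
  ext i j
  fin_cases i <;> fin_cases j <;>
    simp [blockMatrix, Matrix.mul_apply, Fin.sum_univ_succ, Real.exp_add]

theorem blockMatrix_one : blockMatrix 1 0 = 1 := by
  ext i j
  fin_cases i <;> fin_cases j <;> simp [blockMatrix]

/-- `SL(2,ℝ) × ℝ`, realized as the group of all `diag(B, e^t)` with `det B = 1`. -/
def groupSL2R : Subgroup (GL (Fin 3) ℝ) where
  carrier := {A | ∃ (B : Matrix.SpecialLinearGroup (Fin 2) ℝ) (t : ℝ),
    (A : Matrix (Fin 3) (Fin 3) ℝ) = blockMatrix B t}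
  one_mem' := ⟨1, 0, by simp [blockMatrix_one]⟩
  mul_mem' := by
    rintro A A' ⟨B, s, h⟩ ⟨C, t, h'⟩
    exact ⟨B * C, s + t, by
      rw [Units.val_mul, h, h', blockMatrix_mul, Matrix.SpecialLinearGroup.coe_mul]⟩
  inv_mem' := by
    rintro A ⟨B, s, h⟩
    refine ⟨B⁻¹, -s, ?_⟩
    rw [Units.inv_eq_of_mul_eq_one_right]
    rw [h, blockMatrix_mul, ← Matrix.SpecialLinearGroup.coe_mul, mul_inv_cancel, add_neg_cancel,
      Matrix.SpecialLinearGroup.coe_one, blockMatrix_one]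

/-- `ℍ² × ℝ` as the group of all `diag((y, x; 0, 1), e^t)` with `y > 0`. -/
def groupSolvable : Subgroup (GL (Fin 3) ℝ) where
  carrier := {A | ∃ x y t : ℝ, 0 < y ∧
    (A : Matrix (Fin 3) (Fin 3) ℝ) = blockMatrix !![y, x; 0, 1] t}
  one_mem' := ⟨0, 1, 0, one_pos, by simp [← Matrix.one_fin_two, blockMatrix_one]⟩
  mul_mem' := by
    rintro A A' ⟨x, y, s, hy, h⟩ ⟨x', y', t, hy', h'⟩
    refine ⟨y * x' + x, y * y', s + t, mul_pos hy hy', ?_⟩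
    rw [Units.val_mul, h, h', blockMatrix_mul]
    simp
  inv_mem' := by
    rintro A ⟨x, y, s, hy, h⟩
    refine ⟨-(x / y), y⁻¹, -s, inv_pos.2 hy, ?_⟩
    rw [Units.inv_eq_of_mul_eq_one_right]
    rw [h, blockMatrix_mul, add_neg_cancel, ← blockMatrix_one]
    congr 1
    ext i j
    have := hy.ne'
    fin_cases i <;> fin_cases j <;> simp <;> field_simp <;> ring

/-- The action of `diag((a, b; c, d), e^t)` on `ℍ² × ℝ`:
`(w, z) ↦ ((a w + b)/(c w + d), z + t)` with `w = x + i y`. On `groupSolvable` it is the left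
multiplication, for the identification of `diag((y, x; 0, 1), e^z)` with `(x,y,z)`. -/
def actH2R (A : Matrix (Fin 3) (Fin 3) ℝ) (p : Vec 3) : Vec 3 :=
  let w : ℂ := ⟨p 0, p 1⟩
  let w' : ℂ := ((A 0 0 : ℂ) * w + (A 0 1 : ℂ)) / ((A 1 0 : ℂ) * w + (A 1 1 : ℂ))
  ![w'.re, w'.im, p 2 + Real.log (A 2 2)]

end

/-!
Everything is computed in the global chart `(x, y, z)`, with the rotation `hrot` of the horizontal
planes, `hrot ∂_x = ∂_y`, `hrot ∂_y = -∂_x`, `hrot ∂_z = 0`. The curvature of `ℍ² × ℝ` is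
`R(X, Y) Z = dV(X, Y) hrot Z`. If `S` is a homogeneous structure, then each `S_X` is
skew-symmetric and acts trivially on `R`, hence it preserves the kernel `∂_z` of `R` and is a
multiple of `hrot`. So `S = η ⊗ hrot` for a covector field `η = a θ¹ + b θ² + l θ³`
(`IsHomogeneousStructure.form`). The field `hrot` is parallel for `∇̃ = ∇ - S`, so the remaining
condition is `∇̃η = 0`. As `∇ (y ∂_x) = θ¹ ⊗ y ∂_y` and `∇ (y ∂_y) = -θ¹ ⊗ y ∂_x`, it reads
`dl = 0`, `da = -b (η - θ¹)`, `db = a (η - θ¹)` (`IsParallelCovector`).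

In particular `a² + b²` and `l` are constant. Symmetry of the second derivatives of `a` and `b`
says that `η - θ¹` is closed where `(a, b) ≠ 0`, which forces `l = 0` and `a² + b² = 1`
(`IsParallelCovector.integrability`). Hence either `a = b = 0` and `S = T^l`, or `η` is the unit
form tangent to the horocycles at a boundary point of `ℍ²`; that point is a first integral of the
equations (`IsParallelCovector.classification`). For the point `∞` this is `T = θ¹ ⊗ dV`, and for
a real point `ζ` the isometry `w ↦ -1 / (w - ζ)` carries it to `T`. The reflection `x ↦ -x`
changes the sign of `l`. An isomorphism between two tensors of the list preserves their kernels;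
if both are of the form `T^c`, its differential preserves the vertical line, and comparison of
lengths gives `c² = d²`.

For the coset representations, the Lie algebras are found by differentiating the equations of the
groups, and conversely by exponentiating; `det (exp B) = 1` for `tr B = 0` follows from the
conjugacy of `Bᵀ` and `-B` by the rotation by a right angle. A reductive complement of `𝔰𝔬(2)` in
`𝔰𝔩(2,ℝ) ⊕ ℝ` is the graph of an invariant linear map into `𝔰𝔬(2)`, so it is determined by the
multiple `k` of the rotation generator that is added to `∂_z`; a computation of the fundamental
fields at the origin gives the tensor `T^{2k}` there, and both tensors are invariant
(`eqOn_of_invariant`). For the solvable group the complement is the whole Lie algebra, and the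
same computation gives `T`.
-/

/-! ### The Levi-Civita connection and the curvature of `ℍ² × ℝ` -/

/-- The rotation by a right angle of the tangent planes of `ℍ²`, extended by `0` to `∂_z`. The
metric is conformal to the Euclidean one on these planes, so it is constant in coordinates. -/
def hrot (Y : Vec 3) : Vec 3 := ![-Y 1, Y 0, 0]

theorem hrot_vertical : hrot (Pi.single 2 1) = 0 := by
  ext i
  fin_cases i <;> simp [hrot]

theorem isOpen_H2R : IsOpen H2R :=
  isOpen_lt continuous_const (continuous_apply 1)

theorem convex_H2R : Convex ℝ H2R :=
  convex_halfSpace_gt (IsLinearMap.mk (fun _ _ => rfl) fun _ _ => rfl) 0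

theorem origin_mem : originH2R ∈ H2R := by simp [H2R, originH2R]

theorem inv_gH2R {p : Vec 3} (hp : p ∈ H2R) :
    (gH2R p)⁻¹ = Matrix.diagonal ![p 1 ^ 2, p 1 ^ 2, 1] := by
  have h : p 1 ≠ 0 := ne_of_gt hp
  apply Matrix.inv_eq_right_inv
  rw [gH2R, Matrix.diagonal_mul_diagonal, ← Matrix.diagonal_one]
  congr 1
  ext i
  fin_cases i <;> simp [h]

theorem metricAt_gH2R (p X Y : Vec 3) :
    metricAt gH2R p X Y = (X 0 * Y 0 + X 1 * Y 1) / p 1 ^ 2 + X 2 * Y 2 := by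
  simp [metricAt, gH2R, dotProduct, Matrix.mulVec_diagonal, Fin.sum_univ_succ]
  ring

/-- A field that depends on the height `y` only has the derivative `W₁ ∂_y`. -/
theorem fderiv_height {E : Type*} [NormedAddCommGroup E] [NormedSpace ℝ E] {f : ℝ → E} {f' : E}
    {p : Vec 3} (hf : HasDerivAt f f' (p 1)) (W : Vec 3) :
    fderiv ℝ (fun q : Vec 3 => f (q 1)) p W = W 1 • f' := by
  have h := hf.hasFDerivAt.comp p (hasFDerivAt_apply (𝕜 := ℝ) (1 : Fin 3) p)
  rw [show (fun q : Vec 3 => f (q 1)) = f ∘ fun q => q 1 from rfl, h.fderiv]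
  simp

theorem fderiv_metricAt {p : Vec 3} (hp : p ∈ H2R) (W X Y : Vec 3) :
    fderiv ℝ (fun q => metricAt gH2R q X Y) p W
      = -2 * W 1 * (X 0 * Y 0 + X 1 * Y 1) / p 1 ^ 3 := by
  have h : p 1 ≠ 0 := ne_of_gt hp
  have hd : HasDerivAt (fun y : ℝ => (X 0 * Y 0 + X 1 * Y 1) / y ^ 2 + X 2 * Y 2)
      (-2 * (X 0 * Y 0 + X 1 * Y 1) / p 1 ^ 3) (p 1) := by
    have := (((hasDerivAt_id' (p 1)).pow 2).inv (pow_ne_zero 2 h)).const_mul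
      (X 0 * Y 0 + X 1 * Y 1)
    refine (this.add_const (X 2 * Y 2)).congr_deriv ?_
    simp
    field_simp
  simp only [metricAt_gH2R]
  rw [fderiv_height hd, smul_eq_mul]
  ring

theorem christoffel_gH2R {p : Vec 3} (hp : p ∈ H2R) (X Y : Vec 3) :
    christoffel gH2R p X Y
      = (1 / p 1) • ![-(X 0 * Y 1) - X 1 * Y 0, X 0 * Y 0 - X 1 * Y 1, 0] := by
  have h : p 1 ≠ 0 := ne_of_gt hp
  simp only [christoffel, fderiv_metricAt hp, inv_gH2R hp]
  ext i
  fin_cases i <;> simp [Matrix.mulVec_diagonal] <;> field_simp <;> ring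

theorem fderiv_christoffel {p : Vec 3} (hp : p ∈ H2R) (W X Y : Vec 3) :
    fderiv ℝ (fun q => christoffel gH2R q X Y) p W = W 1 • ((-1 / p 1 ^ 2) •
      ![-(X 0 * Y 1) - X 1 * Y 0, X 0 * Y 0 - X 1 * Y 1, 0]) := by
  have h : p 1 ≠ 0 := ne_of_gt hp
  have hd : HasDerivAt
      (fun y : ℝ => (1 / y) • ![-(X 0 * Y 1) - X 1 * Y 0, X 0 * Y 0 - X 1 * Y 1, 0])
      ((-1 / p 1 ^ 2) • ![-(X 0 * Y 1) - X 1 * Y 0, X 0 * Y 0 - X 1 * Y 1, 0]) (p 1) := by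
    simpa using ((hasDerivAt_id' (p 1)).fun_inv h).smul_const
      ![-(X 0 * Y 1) - X 1 * Y 0, X 0 * Y 0 - X 1 * Y 1, 0]
  rw [← fderiv_height hd]
  have he : (fun q => christoffel gH2R q X Y) =ᶠ[nhds p] fun q => (1 / q 1) •
      ![-(X 0 * Y 1) - X 1 * Y 0, X 0 * Y 0 - X 1 * Y 1, 0] :=
    Filter.eventually_of_mem (isOpen_H2R.mem_nhds hp) fun q hq => christoffel_gH2R hq X Y
  rw [he.fderiv_eq]

/-- The curvature of `ℍ² × ℝ`: it is `-1` on the factor `ℍ²` and `0` otherwise. -/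
theorem curvature_gH2R {p : Vec 3} (hp : p ∈ H2R) (X Y Z : Vec 3) :
    curvature gH2R p X Y Z = ((X 0 * Y 1 - X 1 * Y 0) / p 1 ^ 2) • hrot Z := by
  have h : p 1 ≠ 0 := ne_of_gt hp
  simp only [curvature, fderiv_christoffel hp, christoffel_gH2R hp]
  ext i
  fin_cases i <;> simp [hrot] <;> field_simp <;> ring

theorem fderiv_curvature {p : Vec 3} (hp : p ∈ H2R) (W X Y Z : Vec 3) :
    fderiv ℝ (fun q => curvature gH2R q X Y Z) p W
      = W 1 • ((-2 * (X 0 * Y 1 - X 1 * Y 0) / p 1 ^ 3) • hrot Z) := by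
  have h : p 1 ≠ 0 := ne_of_gt hp
  have hd : HasDerivAt (fun y : ℝ => ((X 0 * Y 1 - X 1 * Y 0) / y ^ 2) • hrot Z)
      ((-2 * (X 0 * Y 1 - X 1 * Y 0) / p 1 ^ 3) • hrot Z) (p 1) := by
    have := (((hasDerivAt_id' (p 1)).pow 2).inv (pow_ne_zero 2 h)).const_mul
      (X 0 * Y 1 - X 1 * Y 0)
    refine (this.congr_deriv ?_).smul_const (hrot Z)
    simp
    field_simp
  rw [← fderiv_height hd]
  have he : (fun q => curvature gH2R q X Y Z) =ᶠ[nhds p] fun q =>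
      ((X 0 * Y 1 - X 1 * Y 0) / q 1 ^ 2) • hrot Z :=
    Filter.eventually_of_mem (isOpen_H2R.mem_nhds hp) fun q hq => curvature_gH2R hq X Y Z
  rw [he.fderiv_eq]

theorem tensorFamily_apply (c : ℝ) {p : Vec 3} (hp : p ∈ H2R) (X Y : Vec 3) :
    tensorFamily c p X Y = (c * X 2) • hrot Y := by
  have h : p 1 ≠ 0 := ne_of_gt hp
  ext i
  fin_cases i <;>
    simp [tensorFamily, raiseIndex, sharp, inv_gH2R hp, Matrix.mulVec_diagonal, areaForm, theta1,
      theta2, theta3, hrot] <;> field_simp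

theorem tensorSolvable_apply {p : Vec 3} (hp : p ∈ H2R) (X Y : Vec 3) :
    tensorSolvable p X Y = (X 0 / p 1) • hrot Y := by
  have h : p 1 ≠ 0 := ne_of_gt hp
  ext i
  fin_cases i <;>
    simp [tensorSolvable, raiseIndex, sharp, inv_gH2R hp, Matrix.mulVec_diagonal, areaForm, theta1,
      theta2, hrot] <;> field_simp

theorem hasFDerivAt_quotient {E : Type*} [NormedAddCommGroup E] [NormedSpace ℝ E] {f g : E → ℝ}
    {f' g' : E →L[ℝ] ℝ} {p : E} (hf : HasFDerivAt f f' p) (hg : HasFDerivAt g g' p)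
    (h : g p ≠ 0) :
    HasFDerivAt (fun q => f q / g q) ((1 / g p ^ 2) • (g p • f' - f p • g')) p := by
  have hi : HasFDerivAt (fun q => (g q)⁻¹) (-(g p ^ 2)⁻¹ • g') p :=
    (hasDerivAt_inv h).comp_hasFDerivAt p hg
  refine (hf.fun_mul hi).congr_fderiv ?_
  ext W
  simp
  field_simp
  ring

theorem fderiv_apply_component {n : ℕ} {f : Vec n → Vec n} {p : Vec n}
    (hf : DifferentiableAt ℝ f p) (V : Vec n) (i : Fin n) :
    fderiv ℝ f p V i = fderiv ℝ (fun q => f q i) p V :=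
  (congrArg (fun L => L V)
    ((hasFDerivAt_apply (𝕜 := ℝ) i (f p)).comp p hf.hasFDerivAt).fderiv).symm

/-! ### Homogeneous structures are of the form `η ⊗ hrot` -/

/-- The connection `∇ - η ⊗ hrot` preserves the metric: `hrot` is skew-symmetric. -/
theorem nabla_metric_of_form {S : Tensor12 3} {p : Vec 3} (hp : p ∈ H2R) {η : Vec 3 → ℝ}
    (hS : ∀ X Y, S p X Y = η X • hrot Y) (W X Y : Vec 3) :
    fderiv ℝ (fun q => metricAt gH2R q X Y) p W - metricAt gH2R p (tildeCoeff gH2R S p W X) Y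
      - metricAt gH2R p X (tildeCoeff gH2R S p W Y) = 0 := by
  have h : p 1 ≠ 0 := ne_of_gt hp
  rw [fderiv_metricAt hp]
  simp only [tildeCoeff, metricAt_gH2R, christoffel_gH2R hp, hS]
  simp [hrot]
  field_simp
  ring

/-- The connection `∇ - η ⊗ hrot` preserves the curvature tensor, which is built from `dV` and
`hrot`. -/
theorem nabla_curvature_of_form {S : Tensor12 3} {p : Vec 3} (hp : p ∈ H2R) {η : Vec 3 → ℝ}
    (hS : ∀ X Y, S p X Y = η X • hrot Y) (W X Y Z : Vec 3) :
    fderiv ℝ (fun q => curvature gH2R q X Y Z) p W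
      + tildeCoeff gH2R S p W (curvature gH2R p X Y Z)
      - curvature gH2R p (tildeCoeff gH2R S p W X) Y Z
      - curvature gH2R p X (tildeCoeff gH2R S p W Y) Z
      - curvature gH2R p X Y (tildeCoeff gH2R S p W Z) = 0 := by
  have h : p 1 ≠ 0 := ne_of_gt hp
  simp only [tildeCoeff, fderiv_curvature hp, curvature_gH2R hp, christoffel_gH2R hp, hS]
  ext i
  fin_cases i <;> simp [hrot] <;> field_simp <;> ring

theorem isHomogeneousStructure_tensorFamily (c : ℝ) :
    IsHomogeneousStructure H2R gH2R (tensorFamily c) where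
  smooth X Y := contDiffOn_const.congr fun p hp => tensorFamily_apply c hp X Y
  nabla_metric p hp W X Y := nabla_metric_of_form hp (fun _ _ => tensorFamily_apply c hp _ _) W X Y
  nabla_curvature p hp W X Y Z :=
    nabla_curvature_of_form hp (fun _ _ => tensorFamily_apply c hp _ _) W X Y Z
  nabla_tensor p hp W X Y := by
    have h : p 1 ≠ 0 := ne_of_gt hp
    have he : (fun q => tensorFamily c q X Y) =ᶠ[nhds p] fun _ => (c * X 2) • hrot Y :=
      Filter.eventually_of_mem (isOpen_H2R.mem_nhds hp) fun q hq => tensorFamily_apply c hq X Y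
    simp only [he.fderiv_eq, tildeCoeff, tensorFamily_apply c hp, christoffel_gH2R hp]
    ext i
    fin_cases i <;> simp [hrot] <;> field_simp <;> ring

theorem isHomogeneousStructure_tensorSolvable :
    IsHomogeneousStructure H2R gH2R tensorSolvable where
  smooth X Y := by
    have hy : ContDiffOn ℝ ∞ (fun p : Vec 3 => p 1) H2R := (contDiff_apply ℝ ℝ 1).contDiffOn
    have hd : ContDiffOn ℝ ∞ (fun p : Vec 3 => X 0 / p 1) H2R :=
      contDiffOn_const.div hy fun p hp => ne_of_gt hp
    exact (hd.smul contDiffOn_const).congr fun p hp => tensorSolvable_apply hp X Y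
  nabla_metric p hp W X Y := nabla_metric_of_form (η := fun X => X 0 / p 1) hp
    (fun _ _ => tensorSolvable_apply hp _ _) W X Y
  nabla_curvature p hp W X Y Z := nabla_curvature_of_form (η := fun X => X 0 / p 1) hp
    (fun _ _ => tensorSolvable_apply hp _ _) W X Y Z
  nabla_tensor p hp W X Y := by
    have h : p 1 ≠ 0 := ne_of_gt hp
    have hd : HasDerivAt (fun y : ℝ => (X 0 / y) • hrot Y) ((-X 0 / p 1 ^ 2) • hrot Y) (p 1) := by
      have := ((hasDerivAt_id' (p 1)).fun_inv h).const_mul (X 0)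
      refine (this.congr_deriv ?_).smul_const (hrot Y)
      field_simp
    have he : (fun q => tensorSolvable q X Y) =ᶠ[nhds p] fun q => (X 0 / q 1) • hrot Y :=
      Filter.eventually_of_mem (isOpen_H2R.mem_nhds hp) fun q hq => tensorSolvable_apply hq X Y
    rw [he.fderiv_eq, fderiv_height hd]
    simp only [tildeCoeff, tensorSolvable_apply hp, christoffel_gH2R hp]
    ext i
    fin_cases i <;> simp [hrot] <;> field_simp <;> ring

/-- The component of `η` along `e₁ = y ∂_x`, for a tensor field `η ⊗ hrot`. -/
def coeffX (S : Tensor12 3) (p : Vec 3) : ℝ := p 1 * S p (Pi.single 0 1) (Pi.single 0 1) 1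

/-- The component of `η` along `e₂ = y ∂_y`, for a tensor field `η ⊗ hrot`. -/
def coeffY (S : Tensor12 3) (p : Vec 3) : ℝ := p 1 * S p (Pi.single 1 1) (Pi.single 0 1) 1

/-- The component of `η` along `∂_z`, for a tensor field `η ⊗ hrot`. -/
def coeffZ (S : Tensor12 3) (p : Vec 3) : ℝ := S p (Pi.single 2 1) (Pi.single 0 1) 1

theorem vec3_eq (X : Vec 3) :
    X = X 0 • Pi.single 0 1 + X 1 • Pi.single 1 1 + X 2 • Pi.single 2 1 := by
  ext i
  fin_cases i <;> simp

theorem fderiv_height_mul {f : Vec 3 → ℝ} {p : Vec 3} (hf : DifferentiableAt ℝ f p) (W : Vec 3) :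
    fderiv ℝ (fun q : Vec 3 => q 1 * f q) p W = W 1 * f p + p 1 * fderiv ℝ f p W := by
  have := (hasFDerivAt_apply (𝕜 := ℝ) (1 : Fin 3) p).fun_mul hf.hasFDerivAt
  rw [HasFDerivAt.fderiv this]
  simp
  ring

namespace IsHomogeneousStructure

variable {S : Tensor12 3}

/-- `∇g = 0` and `∇̃g = 0`: the endomorphisms `S_W` are skew-symmetric. The equation `∇g = 0` is
the case `c = 0` of `tensorFamily c`. -/
theorem skew (hS : IsHomogeneousStructure H2R gH2R S) {p : Vec 3} (hp : p ∈ H2R) (W X Y : Vec 3) :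
    metricAt gH2R p (S p W X) Y + metricAt gH2R p X (S p W Y) = 0 := by
  have h : p 1 ≠ 0 := ne_of_gt hp
  have h1 := hS.nabla_metric p hp W X Y
  have h2 := nabla_metric_of_form (S := tensorFamily 0) hp
    (fun _ _ => tensorFamily_apply 0 hp _ _) W X Y
  simp only [tildeCoeff, metricAt_gH2R, Pi.sub_apply, tensorFamily_apply 0 hp, zero_mul, zero_smul,
    sub_zero] at h1 h2 ⊢
  linear_combination h1 - h2

/-- `S_X` preserves the kernel of the curvature form, which is the line of `∂_z`. -/
theorem apply_vertical (hS : IsHomogeneousStructure H2R gH2R S) {p : Vec 3} (hp : p ∈ H2R)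
    (W : Vec 3) : S p W (Pi.single 2 1) = 0 := by
  have h : p 1 ≠ 0 := ne_of_gt hp
  have h1 := hS.nabla_curvature p hp W (Pi.single 0 1) (Pi.single 1 1) (Pi.single 2 1)
  have h2 := hS.skew hp W (Pi.single 2 1) (Pi.single 2 1)
  simp only [tildeCoeff, fderiv_curvature hp, curvature_gH2R hp, christoffel_gH2R hp] at h1
  simp only [metricAt_gH2R] at h2
  simp only [hrot_vertical, smul_zero, map_zero] at h1
  have h10 := congrFun h1 0
  have h11 := congrFun h1 1
  simp [hrot, h] at h10 h11 h2
  ext i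
  fin_cases i
  · simpa using h11
  · simpa using h10
  · simpa using h2

/-- Since `∇̃g = ∇̃R = 0`, each `S_X` is an infinitesimal rotation of `ℍ²`. -/
theorem form (hS : IsHomogeneousStructure H2R gH2R S) {p : Vec 3} (hp : p ∈ H2R) (X Y : Vec 3) :
    S p X Y = ((coeffX S p * X 0 + coeffY S p * X 1) / p 1 + coeffZ S p * X 2) • hrot Y := by
  have h : p 1 ≠ 0 := ne_of_gt hp
  have key : ∀ W, S p W Y = (S p W (Pi.single 0 1) 1) • hrot Y := by
    intro W
    have h00 := hS.skew hp W (Pi.single 0 1) (Pi.single 0 1)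
    have h01 := hS.skew hp W (Pi.single 0 1) (Pi.single 1 1)
    have h11 := hS.skew hp W (Pi.single 1 1) (Pi.single 1 1)
    have h02 := hS.skew hp W (Pi.single 0 1) (Pi.single 2 1)
    have h12 := hS.skew hp W (Pi.single 1 1) (Pi.single 2 1)
    rw [hS.apply_vertical hp] at h02 h12
    simp only [metricAt_gH2R] at h00 h01 h11 h02 h12
    simp [h] at h00 h11 h02 h12
    simp at h01
    field_simp at h01
    conv_lhs => rw [vec3_eq Y]
    simp only [map_add, map_smul, hS.apply_vertical hp]
    ext i
    fin_cases i <;> simp [hrot, h00, h11, h02, h12]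
    · linear_combination Y 1 * h01
    · ring
  rw [key X]
  congr 1
  conv_lhs => rw [vec3_eq X]
  simp only [map_add, map_smul, LinearMap.add_apply, LinearMap.smul_apply, Pi.add_apply,
    Pi.smul_apply, smul_eq_mul, coeffX, coeffY, coeffZ]
  field_simp

theorem contDiffOn_component (hS : IsHomogeneousStructure H2R gH2R S) (X Y : Vec 3) (i : Fin 3) :
    ContDiffOn ℝ ∞ (fun p => S p X Y i) H2R :=
  contDiffOn_pi.1 (hS.smooth X Y) i

theorem contDiffOn_coeffX (hS : IsHomogeneousStructure H2R gH2R S) :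
    ContDiffOn ℝ ∞ (coeffX S) H2R :=
  (contDiff_apply ℝ ℝ 1).contDiffOn.mul (hS.contDiffOn_component _ _ _)

theorem contDiffOn_coeffY (hS : IsHomogeneousStructure H2R gH2R S) :
    ContDiffOn ℝ ∞ (coeffY S) H2R :=
  (contDiff_apply ℝ ℝ 1).contDiffOn.mul (hS.contDiffOn_component _ _ _)

theorem contDiffOn_coeffZ (hS : IsHomogeneousStructure H2R gH2R S) :
    ContDiffOn ℝ ∞ (coeffZ S) H2R :=
  hS.contDiffOn_component _ _ _

theorem fderiv_component (hS : IsHomogeneousStructure H2R gH2R S) {p : Vec 3} (hp : p ∈ H2R)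
    (W X Y : Vec 3) (i : Fin 3) :
    fderiv ℝ (fun q => S q X Y i) p W = (- tildeCoeff gH2R S p W (S p X Y)
      + S p (tildeCoeff gH2R S p W X) Y + S p X (tildeCoeff gH2R S p W Y)) i := by
  have hd : DifferentiableAt ℝ (fun q => S q X Y) p :=
    ((hS.smooth X Y).contDiffAt (isOpen_H2R.mem_nhds hp)).differentiableAt (by simp)
  rw [← fderiv_apply_component hd]
  have := congrFun (hS.nabla_tensor p hp W X Y) i
  simp only [Pi.add_apply, Pi.sub_apply, Pi.zero_apply, Pi.neg_apply] at this ⊢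
  linear_combination this

/-- `η = a θ¹ + b θ² + l θ³` satisfies `∇̃η = 0`: this is the equation for `a`. -/
theorem fderiv_coeffX (hS : IsHomogeneousStructure H2R gH2R S) {p : Vec 3} (hp : p ∈ H2R)
    (W : Vec 3) : fderiv ℝ (coeffX S) p W = -coeffY S p *
      (((coeffX S p - 1) * W 0 + coeffY S p * W 1) / p 1 + coeffZ S p * W 2) := by
  have h : p 1 ≠ 0 := ne_of_gt hp
  have hd := ((hS.contDiffOn_component (Pi.single 0 1) (Pi.single 0 1) 1).contDiffAt
    (isOpen_H2R.mem_nhds hp)).differentiableAt (by simp)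
  unfold coeffX
  rw [fderiv_height_mul hd, hS.fderiv_component hp]
  simp only [hS.form hp, tildeCoeff, christoffel_gH2R hp]
  simp [hrot]
  field_simp
  ring

/-- The equation for `b`. -/
theorem fderiv_coeffY (hS : IsHomogeneousStructure H2R gH2R S) {p : Vec 3} (hp : p ∈ H2R)
    (W : Vec 3) : fderiv ℝ (coeffY S) p W = coeffX S p *
      (((coeffX S p - 1) * W 0 + coeffY S p * W 1) / p 1 + coeffZ S p * W 2) := by
  have h : p 1 ≠ 0 := ne_of_gt hp
  have hd := ((hS.contDiffOn_component (Pi.single 1 1) (Pi.single 0 1) 1).contDiffAt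
    (isOpen_H2R.mem_nhds hp)).differentiableAt (by simp)
  unfold coeffY
  rw [fderiv_height_mul hd, hS.fderiv_component hp]
  simp only [hS.form hp, tildeCoeff, christoffel_gH2R hp]
  simp [hrot]
  field_simp
  ring

/-- The equation for `l`. -/
theorem fderiv_coeffZ (hS : IsHomogeneousStructure H2R gH2R S) {p : Vec 3} (hp : p ∈ H2R)
    (W : Vec 3) : fderiv ℝ (coeffZ S) p W = 0 := by
  have h : p 1 ≠ 0 := ne_of_gt hp
  unfold coeffZ
  rw [hS.fderiv_component hp]
  simp only [hS.form hp, tildeCoeff, christoffel_gH2R hp]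
  simp [hrot]
  field_simp
  ring

end IsHomogeneousStructure

/-! ### Parallel covector fields -/

/-- The smooth functions `a, b, l` on `ℍ² × ℝ` satisfy the equations that say that the covector
field `η = a θ¹ + b θ² + l θ³` is parallel for `∇̃ = ∇ - η ⊗ hrot`: the pair `(a, b)` turns with
the speed `η - θ¹`, because `θ¹` is the connection form of the frame `(y ∂_x, y ∂_y)`. -/
structure IsParallelCovector (a b l : Vec 3 → ℝ) : Prop where
  contDiffOn_fst : ContDiffOn ℝ ∞ a H2R
  contDiffOn_snd : ContDiffOn ℝ ∞ b H2R
  contDiffOn_thd : ContDiffOn ℝ ∞ l H2R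
  fderiv_fst : ∀ p ∈ H2R, ∀ W : Vec 3,
    fderiv ℝ a p W = -b p * (((a p - 1) * W 0 + b p * W 1) / p 1 + l p * W 2)
  fderiv_snd : ∀ p ∈ H2R, ∀ W : Vec 3,
    fderiv ℝ b p W = a p * (((a p - 1) * W 0 + b p * W 1) / p 1 + l p * W 2)
  fderiv_thd : ∀ p ∈ H2R, ∀ W : Vec 3, fderiv ℝ l p W = 0

theorem IsHomogeneousStructure.isParallelCovector {S : Tensor12 3}
    (hS : IsHomogeneousStructure H2R gH2R S) :
    IsParallelCovector (coeffX S) (coeffY S) (coeffZ S) where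
  contDiffOn_fst := hS.contDiffOn_coeffX
  contDiffOn_snd := hS.contDiffOn_coeffY
  contDiffOn_thd := hS.contDiffOn_coeffZ
  fderiv_fst _ hp := hS.fderiv_coeffX hp
  fderiv_snd _ hp := hS.fderiv_coeffY hp
  fderiv_thd _ hp := hS.fderiv_coeffZ hp

theorem eq_of_fderiv_eq_zero {f : Vec 3 → ℝ} (hf : ∀ p ∈ H2R, DifferentiableAt ℝ f p)
    (hf' : ∀ p ∈ H2R, ∀ W, fderiv ℝ f p W = 0) {p q : Vec 3} (hp : p ∈ H2R) (hq : q ∈ H2R) :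
    f p = f q := by
  refine convex_H2R.is_const_of_fderivWithin_eq_zero (𝕜 := ℝ)
    (fun x hx => (hf x hx).differentiableWithinAt) (fun x hx => ?_) hp hq
  rw [fderivWithin_of_isOpen isOpen_H2R hx]
  ext W
  exact hf' x hx W

theorem two_le_infty : (2 : WithTop ℕ∞) ≤ ∞ := WithTop.coe_le_coe.2 le_top

theorem ContDiffAt.fderiv_fderiv_comm {E : Type*} [NormedAddCommGroup E] [NormedSpace ℝ E]
    {f : E → ℝ} {p : E} (hf : ContDiffAt ℝ ∞ f p) (V W : E) :
    fderiv ℝ (fun q => fderiv ℝ f q V) p W = fderiv ℝ (fun q => fderiv ℝ f q W) p V := by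
  have hd : DifferentiableAt ℝ (fderiv ℝ f) p :=
    (hf.fderiv_right (m := 1) (by simpa [one_add_one_eq_two] using two_le_infty)).differentiableAt
      (by simp)
  have hs : IsSymmSndFDerivAt ℝ f p := hf.isSymmSndFDerivAt (by simpa using two_le_infty)
  have key : ∀ V W, fderiv ℝ (fun q => fderiv ℝ f q V) p W = fderiv ℝ (fderiv ℝ f) p W V := by
    intro V W
    rw [fderiv_clm_apply hd (differentiableAt_const V)]
    simp
  rw [key, key]
  exact hs W V

namespace IsParallelCovector

variable {a b l : Vec 3 → ℝ}

theorem differentiableAt_fst (h : IsParallelCovector a b l) {p : Vec 3} (hp : p ∈ H2R) :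
    DifferentiableAt ℝ a p :=
  (h.contDiffOn_fst.contDiffAt (isOpen_H2R.mem_nhds hp)).differentiableAt (by simp)

theorem differentiableAt_snd (h : IsParallelCovector a b l) {p : Vec 3} (hp : p ∈ H2R) :
    DifferentiableAt ℝ b p :=
  (h.contDiffOn_snd.contDiffAt (isOpen_H2R.mem_nhds hp)).differentiableAt (by simp)

theorem differentiableAt_thd (h : IsParallelCovector a b l) {p : Vec 3} (hp : p ∈ H2R) :
    DifferentiableAt ℝ l p :=
  (h.contDiffOn_thd.contDiffAt (isOpen_H2R.mem_nhds hp)).differentiableAt (by simp)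

/-- The derivative of the value of `η - θ¹` on a constant vector field. -/
theorem hasFDerivAt_speed (h : IsParallelCovector a b l) {p : Vec 3} (hp : p ∈ H2R) (V : Vec 3) :
    ∃ L : Vec 3 →L[ℝ] ℝ,
      HasFDerivAt (fun q => ((a q - 1) * V 0 + b q * V 1) / q 1 + l q * V 2) L p ∧
      ∀ W, L W = (((a p - 1) * W 0 + b p * W 1) / p 1 + l p * W 2) * (a p * V 1 - b p * V 0) / p 1
        - ((a p - 1) * V 0 + b p * V 1) * W 1 / p 1 ^ 2 := by
  have hy : p 1 ≠ 0 := ne_of_gt hp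
  have ha := (h.differentiableAt_fst hp).hasFDerivAt
  have hb := (h.differentiableAt_snd hp).hasFDerivAt
  have hl := (h.differentiableAt_thd hp).hasFDerivAt
  have hY := hasFDerivAt_apply (𝕜 := ℝ) (1 : Fin 3) p
  refine ⟨_, (hasFDerivAt_quotient (((ha.sub_const 1).mul_const (V 0)).fun_add
    (hb.mul_const (V 1))) hY hy).fun_add (hl.mul_const (V 2)), fun W => ?_⟩
  simp [h.fderiv_fst p hp, h.fderiv_snd p hp, h.fderiv_thd p hp]
  field_simp
  ring

theorem fderiv_fderiv_fst (h : IsParallelCovector a b l) {p : Vec 3} (hp : p ∈ H2R)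
    (V W : Vec 3) : fderiv ℝ (fun q => fderiv ℝ a q V) p W
      = -(a p * (((a p - 1) * W 0 + b p * W 1) / p 1 + l p * W 2)
          * (((a p - 1) * V 0 + b p * V 1) / p 1 + l p * V 2))
        - b p * ((((a p - 1) * W 0 + b p * W 1) / p 1 + l p * W 2) * (a p * V 1 - b p * V 0) / p 1
          - ((a p - 1) * V 0 + b p * V 1) * W 1 / p 1 ^ 2) := by
  obtain ⟨L, hL, hLW⟩ := h.hasFDerivAt_speed hp V
  have he : (fun q => fderiv ℝ a q V) =ᶠ[nhds p] fun q =>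
      -b q * (((a q - 1) * V 0 + b q * V 1) / q 1 + l q * V 2) :=
    Filter.eventually_of_mem (isOpen_H2R.mem_nhds hp) fun q hq => h.fderiv_fst q hq V
  rw [he.fderiv_eq, ((h.differentiableAt_snd hp).hasFDerivAt.fun_neg.fun_mul hL).fderiv]
  simp [h.fderiv_snd p hp, hLW]
  ring

theorem fderiv_fderiv_snd (h : IsParallelCovector a b l) {p : Vec 3} (hp : p ∈ H2R)
    (V W : Vec 3) : fderiv ℝ (fun q => fderiv ℝ b q V) p W
      = -(b p * (((a p - 1) * W 0 + b p * W 1) / p 1 + l p * W 2)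
          * (((a p - 1) * V 0 + b p * V 1) / p 1 + l p * V 2))
        + a p * ((((a p - 1) * W 0 + b p * W 1) / p 1 + l p * W 2) * (a p * V 1 - b p * V 0) / p 1
          - ((a p - 1) * V 0 + b p * V 1) * W 1 / p 1 ^ 2) := by
  obtain ⟨L, hL, hLW⟩ := h.hasFDerivAt_speed hp V
  have he : (fun q => fderiv ℝ b q V) =ᶠ[nhds p] fun q =>
      a q * (((a q - 1) * V 0 + b q * V 1) / q 1 + l q * V 2) :=
    Filter.eventually_of_mem (isOpen_H2R.mem_nhds hp) fun q hq => h.fderiv_snd q hq V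
  rw [he.fderiv_eq, ((h.differentiableAt_fst hp).hasFDerivAt.fun_mul hL).fderiv]
  simp [h.fderiv_fst p hp, hLW]
  ring

/-- Integrability: where `(a, b) ≠ 0`, the form `η - θ¹` is closed. This determines the length
of `η`. -/
theorem integrability (h : IsParallelCovector a b l) {p : Vec 3} (hp : p ∈ H2R)
    (hab : a p ^ 2 + b p ^ 2 ≠ 0) : l p = 0 ∧ a p ^ 2 + b p ^ 2 = 1 := by
  have hy : p 1 ≠ 0 := ne_of_gt hp
  have hca := (h.contDiffOn_fst.contDiffAt (isOpen_H2R.mem_nhds hp)).fderiv_fderiv_comm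
  have hcb := (h.contDiffOn_snd.contDiffAt (isOpen_H2R.mem_nhds hp)).fderiv_fderiv_comm
  simp only [h.fderiv_fderiv_fst hp, h.fderiv_fderiv_snd hp] at hca hcb
  have a01 := hca (Pi.single 0 1) (Pi.single 1 1)
  have a02 := hca (Pi.single 0 1) (Pi.single 2 1)
  have a12 := hca (Pi.single 1 1) (Pi.single 2 1)
  have b01 := hcb (Pi.single 0 1) (Pi.single 1 1)
  have b02 := hcb (Pi.single 0 1) (Pi.single 2 1)
  have b12 := hcb (Pi.single 1 1) (Pi.single 2 1)
  simp at a01 a02 a12 b01 b02 b12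
  field_simp at a01 a02 a12 b01 b02 b12
  constructor
  · refine (mul_eq_zero.1 (?_ : (a p ^ 2 + b p ^ 2) * l p = 0)).resolve_left hab
    linear_combination b12 + a02
  · refine sub_eq_zero.1 ((mul_eq_zero.1
      (?_ : (a p ^ 2 + b p ^ 2) * (a p ^ 2 + b p ^ 2 - 1) = 0)).resolve_left hab)
    linear_combination b p * a01 - a p * b01

theorem thd_eq (h : IsParallelCovector a b l) {p q : Vec 3} (hp : p ∈ H2R) (hq : q ∈ H2R) :
    l p = l q :=
  eq_of_fderiv_eq_zero (fun _ hx => h.differentiableAt_thd hx) h.fderiv_thd hp hq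

theorem norm_sq_eq (h : IsParallelCovector a b l) {p q : Vec 3} (hp : p ∈ H2R) (hq : q ∈ H2R) :
    a p ^ 2 + b p ^ 2 = a q ^ 2 + b q ^ 2 := by
  simp only [pow_two]
  refine eq_of_fderiv_eq_zero (f := fun p => a p * a p + b p * b p) (fun x hx => ?_)
    (fun x hx W => ?_) hp hq
  · have ha := h.differentiableAt_fst hx
    have hb := h.differentiableAt_snd hx
    exact (ha.mul ha).add (hb.mul hb)
  · have ha := (h.differentiableAt_fst hx).hasFDerivAt
    have hb := (h.differentiableAt_snd hx).hasFDerivAt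
    rw [((ha.fun_mul ha).fun_add (hb.fun_mul hb)).fderiv]
    simp [h.fderiv_fst x hx, h.fderiv_snd x hx]
    ring

/-- Up to the factor `1 - a`, the denominator is `(x (1 - a) - y b)² + (1 - a)²`. -/
theorem center_denom_ne_zero {x y a b : ℝ} (hy : 0 < y) (hab : a ^ 2 + b ^ 2 = 1) :
    (x * x + 1) * (1 - a) - 2 * x * y * b + y * y * (1 + a) ≠ 0 := by
  have ha : a ≤ 1 := by nlinarith [sq_nonneg b]
  intro h0
  have h2 : (x * (1 - a) - y * b) ^ 2 + (1 - a) ^ 2 = 0 := by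
    linear_combination (1 - a) * h0 + y ^ 2 * hab
  have h3 : 1 - a = 0 := by nlinarith [sq_nonneg (x * (1 - a) - y * b)]
  obtain rfl : a = 1 := by linarith
  obtain rfl : b = 0 := by nlinarith
  nlinarith [pow_pos hy 2]

/-- The horizontal unit vector field dual to `η` is tangent to the horocycles at a boundary point
`ζ` of `ℍ²`, and `x - y b / (1 - a) = ζ` where `a ≠ 1`. The quotient below is `1 / (ζ² + 1)`, and it
is `0` for `ζ = ∞`. It is defined everywhere, so its constancy shows that `a = 1` holds everywhere
or nowhere. -/
theorem center_const (h : IsParallelCovector a b 0)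
    (hab : ∀ p ∈ H2R, a p ^ 2 + b p ^ 2 = 1) {p q : Vec 3} (hp : p ∈ H2R) (hq : q ∈ H2R) :
    (1 - a p) / ((p 0 * p 0 + 1) * (1 - a p) - 2 * p 0 * p 1 * b p + p 1 * p 1 * (1 + a p)) =
      (1 - a q) /
        ((q 0 * q 0 + 1) * (1 - a q) - 2 * q 0 * q 1 * b q + q 1 * q 1 * (1 + a q)) := by
  have key : ∀ x ∈ H2R, ∃ L : Vec 3 →L[ℝ] ℝ, HasFDerivAt (fun x => (1 - a x) /
      ((x 0 * x 0 + 1) * (1 - a x) - 2 * x 0 * x 1 * b x + x 1 * x 1 * (1 + a x))) L x ∧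
      ∀ W, L W = 0 := by
    intro x hx
    have hy : (0 : ℝ) < x 1 := hx
    have h1 := hab x hx
    have hE := center_denom_ne_zero (x := x 0) hy h1
    have ha := (h.differentiableAt_fst hx).hasFDerivAt
    have hb := (h.differentiableAt_snd hx).hasFDerivAt
    have hX := hasFDerivAt_apply (𝕜 := ℝ) (0 : Fin 3) x
    have hY := hasFDerivAt_apply (𝕜 := ℝ) (1 : Fin 3) x
    refine ⟨_, hasFDerivAt_quotient (ha.const_sub 1) (((((hX.fun_mul hX).add_const 1).fun_mul
      (ha.const_sub 1)).fun_sub (((hX.const_mul 2).fun_mul hY).fun_mul hb)).fun_add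
      ((hY.fun_mul hY).fun_mul (ha.const_add 1))) hE, fun W => ?_⟩
    simp only [_root_.smul_apply, smul_eq_mul]
    refine mul_eq_zero_of_right _ ?_
    simp [h.fderiv_fst x hx, h.fderiv_snd x hx]
    field_simp
    linear_combination (-x 1 * (2 * x 0 * (-(1 - a x) * W 0 + b x * W 1) - 2 * x 1 * W 1)) * h1
  refine eq_of_fderiv_eq_zero (f := fun x => (1 - a x) /
      ((x 0 * x 0 + 1) * (1 - a x) - 2 * x 0 * x 1 * b x + x 1 * x 1 * (1 + a x)))
      (fun x hx => ?_) (fun x hx W => ?_) hp hq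
  · obtain ⟨L, hL, -⟩ := key x hx
    exact hL.differentiableAt
  · obtain ⟨L, hL, hLW⟩ := key x hx
    rw [hL.fderiv, hLW]

/-- The boundary point at which the horocycles are centered is constant. -/
theorem center_eq (h : IsParallelCovector a b 0)
    (hab : ∀ p ∈ H2R, a p ^ 2 + b p ^ 2 = 1) (ha1 : ∀ p ∈ H2R, a p ≠ 1) {p q : Vec 3}
    (hp : p ∈ H2R) (hq : q ∈ H2R) :
    p 0 - p 1 * b p / (1 - a p) = q 0 - q 1 * b q / (1 - a q) := by
  have key : ∀ x ∈ H2R, ∃ L : Vec 3 →L[ℝ] ℝ,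
      HasFDerivAt (fun x => x 0 - x 1 * b x / (1 - a x)) L x ∧ ∀ W, L W = 0 := by
    intro x hx
    have hy : x 1 ≠ 0 := ne_of_gt hx
    have h1 := hab x hx
    have hm : 1 - a x ≠ 0 := sub_ne_zero.2 (ha1 x hx).symm
    have ha := (h.differentiableAt_fst hx).hasFDerivAt
    have hb := (h.differentiableAt_snd hx).hasFDerivAt
    have hX := hasFDerivAt_apply (𝕜 := ℝ) (0 : Fin 3) x
    have hY := hasFDerivAt_apply (𝕜 := ℝ) (1 : Fin 3) x
    refine ⟨_, hX.fun_sub (hasFDerivAt_quotient (hY.fun_mul hb) (ha.const_sub 1) hm),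
      fun W => ?_⟩
    simp [h.fderiv_fst x hx, h.fderiv_snd x hx]
    field_simp
    linear_combination (-(1 - a x) * W 0 + b x * W 1) * h1
  refine eq_of_fderiv_eq_zero (f := fun x => x 0 - x 1 * b x / (1 - a x))
      (fun x hx => ?_) (fun x hx W => ?_) hp hq
  · obtain ⟨L, hL, -⟩ := key x hx
    exact hL.differentiableAt
  · obtain ⟨L, hL, hLW⟩ := key x hx
    rw [hL.fderiv, hLW]

/-- The solutions: `η = c θ³`, or `η = θ¹`, or the unit form of the horocycles at a real boundary
point `ζ`. -/
theorem classification (h : IsParallelCovector a b l) :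
    (∃ c, ∀ p ∈ H2R, a p = 0 ∧ b p = 0 ∧ l p = c) ∨
    (∀ p ∈ H2R, a p = 1 ∧ b p = 0 ∧ l p = 0) ∨
    ∃ ζ, ∀ p ∈ H2R, a p * ((p 0 - ζ) ^ 2 + p 1 ^ 2) = (p 0 - ζ) ^ 2 - p 1 ^ 2 ∧
      b p * ((p 0 - ζ) ^ 2 + p 1 ^ 2) = 2 * (p 0 - ζ) * p 1 ∧ l p = 0 := by
  by_cases h0 : a originH2R ^ 2 + b originH2R ^ 2 = 0
  · refine Or.inl ⟨l originH2R, fun p hp => ⟨?_, ?_, h.thd_eq hp origin_mem⟩⟩ <;>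
      nlinarith [h.norm_sq_eq hp origin_mem, sq_nonneg (a p), sq_nonneg (b p)]
  have hn : ∀ p ∈ H2R, l p = 0 ∧ a p ^ 2 + b p ^ 2 = 1 := fun p hp =>
    h.integrability hp (by rwa [h.norm_sq_eq hp origin_mem])
  have hab : ∀ p ∈ H2R, a p ^ 2 + b p ^ 2 = 1 := fun p hp => (hn p hp).2
  have h' : IsParallelCovector a b 0 := by
    refine ⟨h.contDiffOn_fst, h.contDiffOn_snd, contDiffOn_const, fun p hp W => ?_,
      fun p hp W => ?_, fun p hp W => by simp⟩
    · rw [h.fderiv_fst p hp, (hn p hp).1, Pi.zero_apply]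
    · rw [h.fderiv_snd p hp, (hn p hp).1, Pi.zero_apply]
  right
  by_cases h1 : ∃ q ∈ H2R, a q = 1
  · left
    obtain ⟨q, hq, hq1⟩ := h1
    intro p hp
    have hc := h'.center_const hab hp hq
    rw [hq1, sub_self, zero_div] at hc
    have ha : a p = 1 := by
      have := (div_eq_zero_iff.1 hc).resolve_right (center_denom_ne_zero hp (hab p hp))
      linarith
    have hb := hab p hp
    rw [ha] at hb
    exact ⟨ha, by nlinarith, (hn p hp).1⟩
  · right
    push Not at h1
    refine ⟨originH2R 0 - originH2R 1 * b originH2R / (1 - a originH2R), fun p hp => ?_⟩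
    rw [← h'.center_eq hab h1 hp origin_mem]
    have h2 := hab p hp
    have hm : 1 - a p ≠ 0 := sub_ne_zero.2 (h1 p hp).symm
    refine ⟨?_, ?_, (hn p hp).1⟩
    · simp only [sub_sub_cancel]
      field_simp
      linear_combination (a p - 1) * p 1 ^ 2 * h2
    · simp only [sub_sub_cancel]
      field_simp
      linear_combination b p * p 1 ^ 2 * h2

end IsParallelCovector

/-! ### Isometries of `ℍ² × ℝ` -/

/-- The action in real coordinates. Where the denominator vanishes, both sides have the same junk
values, so no hypothesis is needed. -/
theorem actH2R_eq (A : Matrix (Fin 3) (Fin 3) ℝ) (p : Vec 3) :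
    actH2R A p =
      ![((A 0 0 * p 0 + A 0 1) * (A 1 0 * p 0 + A 1 1) + A 0 0 * A 1 0 * (p 1 * p 1)) /
          ((A 1 0 * p 0 + A 1 1) * (A 1 0 * p 0 + A 1 1)
            + (A 1 0 * p 1) * (A 1 0 * p 1)),
        (A 0 0 * A 1 1 - A 0 1 * A 1 0) * p 1 /
          ((A 1 0 * p 0 + A 1 1) * (A 1 0 * p 0 + A 1 1)
            + (A 1 0 * p 1) * (A 1 0 * p 1)),
        p 2 + Real.log (A 2 2)] := by
  ext i
  fin_cases i
  · simp [actH2R, Complex.div_re, Complex.normSq_apply]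
    ring
  · simp [actH2R, Complex.div_im, Complex.normSq_apply]
    ring
  · simp [actH2R]

theorem actH2R_blockMatrix (B : Matrix (Fin 2) (Fin 2) ℝ) (t : ℝ) (p : Vec 3) :
    actH2R (blockMatrix B t) p =
      ![((B 0 0 * p 0 + B 0 1) * (B 1 0 * p 0 + B 1 1) + B 0 0 * B 1 0 * (p 1 * p 1)) /
          ((B 1 0 * p 0 + B 1 1) * (B 1 0 * p 0 + B 1 1)
            + (B 1 0 * p 1) * (B 1 0 * p 1)),
        B.det * p 1 /
          ((B 1 0 * p 0 + B 1 1) * (B 1 0 * p 0 + B 1 1)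
            + (B 1 0 * p 1) * (B 1 0 * p 1)),
        p 2 + t] := by
  rw [actH2R_eq, Matrix.det_fin_two]
  simp [blockMatrix]

section Mobius

variable {B : Matrix (Fin 2) (Fin 2) ℝ} {p : Vec 3}

/-- The squared modulus of the denominator `c w + d`. -/
theorem denom_pos (hB : 0 < B.det) (hp : p ∈ H2R) :
    0 < (B 1 0 * p 0 + B 1 1) * (B 1 0 * p 0 + B 1 1) + (B 1 0 * p 1) * (B 1 0 * p 1) := by
  have hy : p 1 ≠ 0 := ne_of_gt hp
  by_cases hc : B 1 0 = 0
  · have hd : B 1 1 ≠ 0 := by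
      intro hd
      rw [Matrix.det_fin_two, hc, hd] at hB
      simp at hB
    have := mul_self_pos.2 hd
    simpa [hc] using this
  · have := mul_self_pos.2 (mul_ne_zero hc hy)
    nlinarith [mul_self_nonneg (B 1 0 * p 0 + B 1 1)]

theorem act_mem (hB : 0 < B.det) (t : ℝ) (hp : p ∈ H2R) : actH2R (blockMatrix B t) p ∈ H2R := by
  change 0 < actH2R (blockMatrix B t) p 1
  rw [actH2R_blockMatrix]
  exact div_pos (mul_pos hB hp) (denom_pos hB hp)

theorem act_contDiffOn (hB : 0 < B.det) (t : ℝ) :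
    ContDiffOn ℝ ∞ (actH2R (blockMatrix B t)) H2R := by
  have h0 : ContDiffOn ℝ ∞ (fun p : Vec 3 => p 0) H2R := (contDiff_apply ℝ ℝ 0).contDiffOn
  have h1 : ContDiffOn ℝ ∞ (fun p : Vec 3 => p 1) H2R := (contDiff_apply ℝ ℝ 1).contDiffOn
  have h2 : ContDiffOn ℝ ∞ (fun p : Vec 3 => p 2) H2R := (contDiff_apply ℝ ℝ 2).contDiffOn
  have hn : ContDiffOn ℝ ∞ (fun p : Vec 3 => (B 1 0 * p 0 + B 1 1) * (B 1 0 * p 0 + B 1 1)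
      + (B 1 0 * p 1) * (B 1 0 * p 1)) H2R := by fun_prop
  refine contDiffOn_pi.2 fun i => ?_
  simp only [actH2R_blockMatrix]
  fin_cases i
  · exact ContDiffOn.div (by fun_prop) hn fun p hp => (denom_pos hB hp).ne'
  · exact ContDiffOn.div (by fun_prop) hn fun p hp => (denom_pos hB hp).ne'
  · exact h2.add contDiffOn_const

/-- The differential of `w ↦ (a w + b) / (c w + d)` is the multiplication by
`det B / (c w + d)²`. -/
theorem fderiv_act (hB : 0 < B.det) (t : ℝ) (hp : p ∈ H2R) (W : Vec 3) :
    fderiv ℝ (actH2R (blockMatrix B t)) p W =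
      ![B.det * (((B 1 0 * p 0 + B 1 1) ^ 2 - (B 1 0 * p 1) ^ 2) * W 0
            + 2 * (B 1 0 * p 0 + B 1 1) * (B 1 0 * p 1) * W 1) /
          ((B 1 0 * p 0 + B 1 1) * (B 1 0 * p 0 + B 1 1) + (B 1 0 * p 1) * (B 1 0 * p 1)) ^ 2,
        B.det * (((B 1 0 * p 0 + B 1 1) ^ 2 - (B 1 0 * p 1) ^ 2) * W 1
            - 2 * (B 1 0 * p 0 + B 1 1) * (B 1 0 * p 1) * W 0) /
          ((B 1 0 * p 0 + B 1 1) * (B 1 0 * p 0 + B 1 1) + (B 1 0 * p 1) * (B 1 0 * p 1)) ^ 2,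
        W 2] := by
  have hn := (denom_pos hB hp).ne'
  have hd : DifferentiableAt ℝ (actH2R (blockMatrix B t)) p :=
    ((act_contDiffOn hB t).contDiffAt (isOpen_H2R.mem_nhds hp)).differentiableAt (by simp)
  have hX := hasFDerivAt_apply (𝕜 := ℝ) (0 : Fin 3) p
  have hY := hasFDerivAt_apply (𝕜 := ℝ) (1 : Fin 3) p
  have hZ := hasFDerivAt_apply (𝕜 := ℝ) (2 : Fin 3) p
  have hu := (hX.const_mul (B 1 0)).add_const (B 1 1)
  have hv := hY.const_mul (B 1 0)
  have hN := (hu.fun_mul hu).fun_add (hv.fun_mul hv)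
  ext i
  rw [fderiv_apply_component hd]
  simp only [actH2R_blockMatrix]
  fin_cases i
  · have := hasFDerivAt_quotient (((((hX.const_mul (B 0 0)).add_const (B 0 1)).fun_mul hu)).fun_add
      ((hY.fun_mul hY).const_mul (B 0 0 * B 1 0))) hN hn
    simp only [Fin.zero_eta, cons_val_zero]
    rw [this.fderiv]
    simp [Matrix.det_fin_two]
    field_simp
    ring
  · have := hasFDerivAt_quotient (hY.const_mul B.det) hN hn
    simp only [Fin.mk_one, cons_val_one, cons_val_zero]
    rw [this.fderiv]
    simp
    field_simp
    ring
  · have := hZ.add_const t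
    simp only [Fin.reduceFinMk, cons_val]
    rw [this.fderiv]
    simp

theorem fderiv_act_hrot (hB : 0 < B.det) (t : ℝ) (hp : p ∈ H2R) (W : Vec 3) :
    fderiv ℝ (actH2R (blockMatrix B t)) p (hrot W)
      = hrot (fderiv ℝ (actH2R (blockMatrix B t)) p W) := by
  rw [fderiv_act hB t hp, fderiv_act hB t hp]
  ext i
  fin_cases i <;> simp [hrot]
  ring

theorem fderiv_act_two (hB : 0 < B.det) (t : ℝ) (hp : p ∈ H2R) (W : Vec 3) :
    fderiv ℝ (actH2R (blockMatrix B t)) p W 2 = W 2 := by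
  simp [fderiv_act hB t hp]

theorem act_blockMatrix_mul (B : Matrix (Fin 2) (Fin 2) ℝ) {C : Matrix (Fin 2) (Fin 2) ℝ}
    (hC : 0 < C.det) (s t : ℝ) (hp : p ∈ H2R) :
    actH2R (blockMatrix B s * blockMatrix C t) p
      = actH2R (blockMatrix B s) (actH2R (blockMatrix C t) p) := by
  have hn : ((C 1 0 : ℂ) * ⟨p 0, p 1⟩ + (C 1 1 : ℂ)) ≠ 0 := by
    intro h0
    have h := (denom_pos hC hp).ne'
    have h1 := congrArg Complex.re h0
    have h2 := congrArg Complex.im h0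
    simp at h1 h2
    rw [h1] at h
    apply h
    rcases h2 with h2 | h2 <;> simp [h2]
  rw [blockMatrix_mul]
  have key : ((((B * C) 0 0 : ℝ) : ℂ) * ⟨p 0, p 1⟩ + (((B * C) 0 1 : ℝ) : ℂ)) /
      ((((B * C) 1 0 : ℝ) : ℂ) * ⟨p 0, p 1⟩ + (((B * C) 1 1 : ℝ) : ℂ))
      = ((B 0 0 : ℂ) * (((C 0 0 : ℂ) * ⟨p 0, p 1⟩ + C 0 1) / ((C 1 0 : ℂ) * ⟨p 0, p 1⟩ + C 1 1))
          + B 0 1) /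
        ((B 1 0 : ℂ) * (((C 0 0 : ℂ) * ⟨p 0, p 1⟩ + C 0 1) / ((C 1 0 : ℂ) * ⟨p 0, p 1⟩ + C 1 1))
          + B 1 1) := by
    generalize (⟨p 0, p 1⟩ : ℂ) = w at hn
    rw [← mul_div_mul_right _ ((B 1 0 : ℂ) * _ + _) hn]
    simp only [add_mul, mul_assoc, div_mul_cancel₀ _ hn]
    simp only [Matrix.mul_apply, Fin.sum_univ_two]
    push_cast
    congr 1 <;> ring
  ext i
  fin_cases i
  · simpa [actH2R, blockMatrix] using congrArg Complex.re key
  · simpa [actH2R, blockMatrix] using congrArg Complex.im key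
  · simp [actH2R, blockMatrix]
    ring

theorem act_one (p : Vec 3) : actH2R 1 p = p := by
  rw [actH2R_eq]
  ext i
  fin_cases i <;> simp

theorem act_blockMatrix_inv (hB : 0 < B.det) (t : ℝ) (hp : p ∈ H2R) :
    actH2R (blockMatrix B⁻¹ (-t)) (actH2R (blockMatrix B t) p) = p := by
  rw [← act_blockMatrix_mul _ hB _ _ hp, blockMatrix_mul,
    Matrix.nonsing_inv_mul _ (isUnit_iff_ne_zero.2 hB.ne'), neg_add_cancel, blockMatrix_one,
    act_one]

/-- The fractional linear maps of positive determinant, together with the translations of the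
factor `ℝ`, are isometries. -/
theorem act_isometry (hB : 0 < B.det) (t : ℝ) :
    IsRiemannianIsometry H2R gH2R (actH2R (blockMatrix B t)) := by
  have hB' : 0 < (B⁻¹).det := by
    rw [Matrix.det_nonsing_inv, Ring.inverse_eq_inv']
    exact inv_pos.2 hB
  refine ⟨act_contDiffOn hB t, fun p hp => act_mem hB t hp, ⟨actH2R (blockMatrix B⁻¹ (-t)),
    act_contDiffOn hB' (-t), fun p hp => act_mem hB' (-t) hp,
    fun p hp => act_blockMatrix_inv hB t hp, fun p hp => ?_⟩, fun p hp X Y => ?_⟩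
  · have := act_blockMatrix_inv hB' (-t) hp
    rwa [Matrix.nonsing_inv_nonsing_inv _ (isUnit_iff_ne_zero.2 hB.ne'), neg_neg] at this
  · have hn := (denom_pos hB hp).ne'
    have hy : p 1 ≠ 0 := ne_of_gt hp
    have hD := hB.ne'
    rw [metricAt_gH2R, metricAt_gH2R, fderiv_act hB t hp, fderiv_act hB t hp, actH2R_blockMatrix]
    generalize B 1 0 * p 0 + B 1 1 = u at hn
    generalize B 1 0 * p 1 = v at hn
    have hn' : u ^ 2 + v ^ 2 ≠ 0 := by rwa [pow_two, pow_two]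
    simp
    field_simp
    ring

end Mobius

/-- The differential of an isometry is injective, hence onto. -/
theorem IsRiemannianIsometry.fderiv_surjective {φ : Vec 3 → Vec 3}
    (hφ : IsRiemannianIsometry H2R gH2R φ) {p : Vec 3} (hp : p ∈ H2R) :
    Function.Surjective (fderiv ℝ φ p) := by
  have hinj : Function.Injective (fderiv ℝ φ p : Vec 3 →ₗ[ℝ] Vec 3) := by
    rw [← LinearMap.ker_eq_bot, LinearMap.ker_eq_bot']
    intro X hX
    have hy : (0 : ℝ) < p 1 ^ 2 := pow_pos hp 2
    have h := hφ.metric p hp X X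
    rw [ContinuousLinearMap.coe_coe] at hX
    rw [hX, metricAt_gH2R, metricAt_gH2R] at h
    simp at h
    have h0 : 0 ≤ (X 0 * X 0 + X 1 * X 1) / p 1 ^ 2 := by
      have := mul_self_nonneg (X 0)
      have := mul_self_nonneg (X 1)
      positivity
    have h2 : X 2 * X 2 = 0 := by nlinarith [mul_self_nonneg (X 2)]
    have h01 : (X 0 * X 0 + X 1 * X 1) / p 1 ^ 2 = 0 := by linarith
    rw [div_eq_zero_iff] at h01
    have h3 := h01.resolve_right hy.ne'
    ext i
    fin_cases i <;> simp <;> nlinarith [mul_self_nonneg (X 0), mul_self_nonneg (X 1)]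
  exact LinearMap.surjective_of_injective hinj

/-- The reflection in the geodesic plane `x = 0`. -/
def reflectX (p : Vec 3) : Vec 3 := ![-p 0, p 1, p 2]

theorem fderiv_reflectX (p W : Vec 3) : fderiv ℝ reflectX p W = reflectX W := by
  have hl : IsLinearMap ℝ reflectX := ⟨fun X Y => by
    ext i
    fin_cases i <;> simp [reflectX]
    ring, fun c X => by
    ext i
    fin_cases i <;> simp [reflectX]⟩
  have := (LinearMap.toContinuousLinearMap hl.mk').hasFDerivAt (x := p)
  exact congrArg (fun L => L W) this.fderiv

theorem reflectX_isometry : IsRiemannianIsometry H2R gH2R reflectX := by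
  have hs : ContDiffOn ℝ ∞ reflectX H2R := by
    refine contDiffOn_pi.2 fun i => ?_
    fin_cases i
    · exact (contDiff_apply ℝ ℝ (0 : Fin 3)).neg.contDiffOn
    · exact (contDiff_apply ℝ ℝ (1 : Fin 3)).contDiffOn
    · exact (contDiff_apply ℝ ℝ (2 : Fin 3)).contDiffOn
  have hm : MapsTo reflectX H2R H2R := fun p hp => by simpa [H2R, reflectX] using hp
  have hi : ∀ p, reflectX (reflectX p) = p := fun p => by
    ext i
    fin_cases i <;> simp [reflectX]
  refine ⟨hs, hm, ⟨reflectX, hs, hm, fun p _ => hi p, fun p _ => hi p⟩, fun p _ X Y => ?_⟩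
  rw [metricAt_gH2R, metricAt_gH2R, fderiv_reflectX, fderiv_reflectX]
  simp [reflectX]

theorem id_isometry : IsRiemannianIsometry H2R gH2R id :=
  ⟨contDiffOn_id, mapsTo_id _, ⟨id, contDiffOn_id, mapsTo_id _, fun _ _ => rfl, fun _ _ => rfl⟩,
    fun p _ X Y => by simp⟩

/-! ### Isomorphisms of homogeneous structure tensors -/

theorem IsHomogeneousStructure.isomorphic {S : Tensor12 3}
    (hS : IsHomogeneousStructure H2R gH2R S) :
    (∃ c : ℝ, 0 ≤ c ∧ IsomorphicTensors H2R gH2R S (tensorFamily c)) ∨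
      IsomorphicTensors H2R gH2R S tensorSolvable := by
  rcases hS.isParallelCovector.classification with ⟨c, hc⟩ | h1 | ⟨ζ, hζ⟩
  · left
    rcases le_total 0 c with h0 | h0
    · refine ⟨c, h0, id, id_isometry, fun p hp X Y => ?_⟩
      obtain ⟨ha, hb, hl⟩ := hc p hp
      simp [hS.form hp, tensorFamily_apply c hp, ha, hb, hl]
    · refine ⟨-c, neg_nonneg.2 h0, reflectX, reflectX_isometry, fun p hp X Y => ?_⟩
      obtain ⟨ha, hb, hl⟩ := hc p hp
      rw [tensorFamily_apply (-c) (reflectX_isometry.mapsTo hp), hS.form hp, ha, hb, hl]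
      simp only [fderiv_reflectX]
      ext i
      fin_cases i <;> simp [reflectX, hrot]
  · refine Or.inr ⟨id, id_isometry, fun p hp X Y => ?_⟩
    obtain ⟨ha, hb, hl⟩ := h1 p hp
    simp [hS.form hp, tensorSolvable_apply hp, ha, hb, hl]
  · right
    -- the map `w ↦ -1 / (w - ζ)` sends the horocycles at `ζ` to those at `∞`
    have hB : 0 < (!![0, -1; 1, -ζ] : Matrix (Fin 2) (Fin 2) ℝ).det := by simp
    refine ⟨actH2R (blockMatrix !![0, -1; 1, -ζ] 0), act_isometry hB 0, fun p hp X Y => ?_⟩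
    obtain ⟨ha, hb, hl⟩ := hζ p hp
    have hy : 0 < p 1 := hp
    have hN : 0 < (p 0 - ζ) ^ 2 + p 1 ^ 2 := by positivity
    rw [tensorSolvable_apply (act_mem hB 0 hp), hS.form hp, hl, map_smul, fderiv_act_hrot hB 0 hp]
    congr 1
    rw [← eq_div_iff hN.ne'] at ha hb
    have hN' : (p 0 + -ζ) * (p 0 + -ζ) + p 1 * p 1 ≠ 0 := by
      have : (p 0 + -ζ) * (p 0 + -ζ) + p 1 * p 1 = (p 0 - ζ) ^ 2 + p 1 ^ 2 := by ring
      rw [this]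
      exact hN.ne'
    rw [fderiv_act hB 0 hp, actH2R_blockMatrix, ha, hb]
    simp
    field_simp
    ring

section Differential

variable {φ : Vec 3 → Vec 3}

/-- If the differential of an isometry at the origin preserves the vertical line, it acts on it by
`±1` and preserves its orthogonal complement. -/
theorem fderiv_vertical (hφ : IsRiemannianIsometry H2R gH2R φ)
    (hv : hrot (fderiv ℝ φ originH2R (Pi.single 2 1)) = 0) :
    fderiv ℝ φ originH2R (Pi.single 2 1) 2 ^ 2 = 1 ∧
      ∀ X : Vec 3, X 2 = 0 → fderiv ℝ φ originH2R X 2 = 0 := by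
  have h0 := congrFun hv 0
  have h1 := congrFun hv 1
  simp [hrot] at h0 h1
  have hm := hφ.metric _ origin_mem (Pi.single 2 1) (Pi.single 2 1)
  rw [metricAt_gH2R, metricAt_gH2R, h0, h1] at hm
  simp at hm
  refine ⟨by rw [sq, hm], fun X hX => ?_⟩
  have hX' := hφ.metric _ origin_mem (Pi.single 2 1) X
  rw [metricAt_gH2R, metricAt_gH2R, h0, h1, hX] at hX'
  simp at hX'
  refine hX'.resolve_left fun h => ?_
  rw [h] at hm
  simp at hm

theorem eq_of_isomorphic_tensorFamily {c d : ℝ} (hc : 0 ≤ c) (hd : 0 ≤ d)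
    (h : IsomorphicTensors H2R gH2R (tensorFamily c) (tensorFamily d)) : c = d := by
  obtain ⟨φ, hφ, hi⟩ := h
  have ho := origin_mem
  have hq := hφ.mapsTo ho
  have hT : ∀ X Y : Vec 3, (c * X 2) • fderiv ℝ φ originH2R (hrot Y)
      = (d * fderiv ℝ φ originH2R X 2) • hrot (fderiv ℝ φ originH2R Y) := by
    intro X Y
    have := hi _ ho X Y
    rwa [tensorFamily_apply c ho, tensorFamily_apply d hq, map_smul] at this
  have he : hrot (Pi.single 0 1) = Pi.single 1 1 := by
    ext i
    fin_cases i <;> simp [hrot]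
  have hm0 := hφ.metric _ ho (Pi.single 0 1) (Pi.single 0 1)
  have hm1 := hφ.metric _ ho (Pi.single 1 1) (Pi.single 1 1)
  set L := fderiv ℝ φ originH2R with hL
  by_cases hd0 : d = 0
  · have h1 := hT (Pi.single 2 1) (Pi.single 0 1)
    rw [hd0, zero_mul, zero_smul, he, smul_eq_zero] at h1
    rcases h1 with h1 | h1
    · simpa [hd0] using h1
    · rw [h1, metricAt_gH2R, metricAt_gH2R] at hm1
      simp [originH2R] at hm1
  · -- the kernel of `T^d`, the vertical line, is preserved
    have hv : hrot (L (Pi.single 2 1)) = 0 := by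
      obtain ⟨X, hX⟩ := hφ.fderiv_surjective ho (Pi.single 2 1)
      have h1 := hT X (Pi.single 2 1)
      rw [hrot_vertical, map_zero, smul_zero, hL, hX] at h1
      have := (smul_eq_zero.1 h1.symm).resolve_left (by simpa using hd0)
      exact this
    obtain ⟨hs, hh⟩ := fderiv_vertical hφ hv
    have h0 : L (Pi.single 0 1) 2 = 0 := hh _ (by simp)
    have h1 : L (Pi.single 1 1) 2 = 0 := hh _ (by simp)
    have h2 := hT (Pi.single 2 1) (Pi.single 0 1)
    rw [he] at h2
    have h20 := congrFun h2 0
    have h21 := congrFun h2 1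
    rw [metricAt_gH2R, metricAt_gH2R, h0] at hm0
    rw [metricAt_gH2R, metricAt_gH2R, h1] at hm1
    simp [hrot] at h20 h21
    have ho1 : originH2R 1 = 1 := rfl
    simp [ho1] at hm0 hm1
    have hy : φ originH2R 1 ≠ 0 := ne_of_gt hq
    field_simp at hm0 hm1
    rw [← hL] at hs
    have hsq : c ^ 2 = d ^ 2 := by
      have hy2 : φ originH2R 1 ^ 2 ≠ 0 := pow_ne_zero 2 hy
      apply mul_right_cancel₀ hy2
      linear_combination -c ^ 2 * hm1
        + (c * L (Pi.single 1 1) 0 - d * L (Pi.single 2 1) 2 * L (Pi.single 0 1) 1) * h20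
        + (c * L (Pi.single 1 1) 1 + d * L (Pi.single 2 1) 2 * L (Pi.single 0 1) 0) * h21
        + d ^ 2 * L (Pi.single 2 1) 2 ^ 2 * hm0 + d ^ 2 * φ originH2R 1 ^ 2 * hs
    exact (sq_eq_sq₀ hc hd).1 hsq

theorem not_isomorphic_tensorSolvable (c : ℝ) :
    ¬ IsomorphicTensors H2R gH2R (tensorFamily c) tensorSolvable := by
  rintro ⟨φ, hφ, hi⟩
  have ho := origin_mem
  have hq := hφ.mapsTo ho
  have hy : φ originH2R 1 ≠ 0 := ne_of_gt hq
  have hT : ∀ X Y : Vec 3, (c * X 2) • fderiv ℝ φ originH2R (hrot Y)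
      = (fderiv ℝ φ originH2R X 0 / φ originH2R 1) • hrot (fderiv ℝ φ originH2R Y) := by
    intro X Y
    have := hi _ ho X Y
    rwa [tensorFamily_apply c ho, tensorSolvable_apply hq, map_smul] at this
  obtain ⟨X, hX⟩ := hφ.fderiv_surjective ho (Pi.single 0 1)
  have hv : hrot (fderiv ℝ φ originH2R (Pi.single 2 1)) = 0 := by
    have h1 := hT X (Pi.single 2 1)
    rw [hrot_vertical, map_zero, smul_zero, hX] at h1
    exact (smul_eq_zero.1 h1.symm).resolve_left (by simpa using hy)
  -- `T` kills the vertical line in its first argument, so that `c = 0`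
  have hc : c = 0 := by
    have h0 := congrFun hv 1
    simp [hrot] at h0
    have h1 := hT (Pi.single 2 1) (Pi.single 0 1)
    rw [h0, zero_div, zero_smul, smul_eq_zero] at h1
    rcases h1 with h1 | h1
    · simpa using h1
    · have hm := hφ.metric _ ho (hrot (Pi.single 0 1)) (hrot (Pi.single 0 1))
      rw [h1, metricAt_gH2R, metricAt_gH2R] at hm
      simp [originH2R, hrot] at hm
  have h1 := congrFun (hT X X) 1
  rw [hc, hX] at h1
  simp [hrot] at h1
  exact hy h1.symm

end Differential

/-! ### Matrix exponentials and fundamental fields -/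

/-- The block diagonal matrix `diag(B, s)`. The Lie algebras of the two groups consist of such
matrices. -/
def blockSum (B : Matrix (Fin 2) (Fin 2) ℝ) (s : ℝ) : Matrix (Fin 3) (Fin 3) ℝ :=
  !![B 0 0, B 0 1, 0; B 1 0, B 1 1, 0; 0, 0, s]

/-- `blockSum` as a ring homomorphism, through which the exponential passes. -/
def blockSumHom : Matrix (Fin 2) (Fin 2) ℝ × ℝ →+* Matrix (Fin 3) (Fin 3) ℝ where
  toFun x := blockSum x.1 x.2
  map_one' := by
    ext i j
    fin_cases i <;> fin_cases j <;> simp [blockSum]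
  map_zero' := by
    ext i j
    fin_cases i <;> fin_cases j <;> simp [blockSum]
  map_mul' x y := by
    ext i j
    fin_cases i <;> fin_cases j <;> simp [blockSum, Matrix.mul_apply, Fin.sum_univ_succ]
  map_add' x y := by
    ext i j
    fin_cases i <;> fin_cases j <;> simp [blockSum]

theorem smul_blockSum (t : ℝ) (B : Matrix (Fin 2) (Fin 2) ℝ) (s : ℝ) :
    t • blockSum B s = blockSum (t • B) (t * s) := by
  ext i j
  fin_cases i <;> fin_cases j <;> simp [blockSum]

section Exp

open scoped Matrix.Norms.Operator

theorem continuous_blockSumHom : Continuous blockSumHom := by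
  refine continuous_matrix fun i j => ?_
  have h : ∀ i j : Fin 2, Continuous fun x : Matrix (Fin 2) (Fin 2) ℝ × ℝ => x.1 i j :=
    fun i j => continuous_fst.matrix_elem i j
  fin_cases i <;> fin_cases j <;>
    first | exact continuous_const | exact continuous_snd | exact h _ _

theorem exp_blockSum (B : Matrix (Fin 2) (Fin 2) ℝ) (s : ℝ) :
    NormedSpace.exp (blockSum B s) = blockMatrix (NormedSpace.exp B) s := by
  have h := NormedSpace.map_exp blockSumHom continuous_blockSumHom (B, s)
  change _ = NormedSpace.exp (blockSum B s) at h
  rw [← h]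
  have h1 : (NormedSpace.exp (B, s)).1 = NormedSpace.exp B := Prod.fst_exp (B, s)
  have h2 : (NormedSpace.exp (B, s)).2 = Real.exp s := by
    rw [Real.exp_eq_exp_ℝ]
    exact Prod.snd_exp (B, s)
  change blockSum _ _ = _
  calc blockSum (NormedSpace.exp (B, s)).1 (NormedSpace.exp (B, s)).2
      = blockSum (NormedSpace.exp B) (Real.exp s) := congrArg₂ blockSum h1 h2
    _ = blockMatrix (NormedSpace.exp B) s := rfl

theorem hasDerivAt_exp_entry {m : ℕ} (X : Matrix (Fin m) (Fin m) ℝ) (i j : Fin m) :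
    HasDerivAt (fun t : ℝ => NormedSpace.exp (t • X) i j) (X i j) 0 := by
  have h := hasDerivAt_exp_smul_const (𝕂 := ℝ) X 0
  rw [zero_smul, NormedSpace.exp_zero, one_mul] at h
  let l : Matrix (Fin m) (Fin m) ℝ →L[ℝ] ℝ :=
    LinearMap.toContinuousLinearMap (Matrix.entryLinearMap ℝ ℝ i j)
  exact l.hasFDerivAt.comp_hasDerivAt 0 h

theorem exp_mulVec_of_eigenvector {m : ℕ} {X : Matrix (Fin m) (Fin m) ℝ} {v : Fin m → ℝ} {a : ℝ}
    (h : X *ᵥ v = a • v) : NormedSpace.exp X *ᵥ v = Real.exp a • v := by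
  have h1 := NormedSpace.exp_series_hasSum_exp' (𝕂 := ℝ) X
  let l : Matrix (Fin m) (Fin m) ℝ →L[ℝ] (Fin m → ℝ) :=
    LinearMap.toContinuousLinearMap
      { toFun := fun M => M *ᵥ v
        map_add' := fun M N => Matrix.add_mulVec M N v
        map_smul' := fun c M => Matrix.smul_mulVec c M v }
  have hl := h1.mapL l
  have hpow : ∀ n : ℕ, (X ^ n) *ᵥ v = a ^ n • v := by
    intro n
    induction n with
    | zero => simp
    | succ n ih => rw [pow_succ, ← Matrix.mulVec_mulVec, h, Matrix.mulVec_smul, ih, smul_smul,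
        pow_succ']
  have h2 := (NormedSpace.exp_series_hasSum_exp' (𝕂 := ℝ) a).smul_const v
  rw [← Real.exp_eq_exp_ℝ] at h2
  refine hl.unique (h2.congr_fun ?_)
  intro n
  change ((n.factorial : ℝ)⁻¹ • X ^ n) *ᵥ v = _
  rw [Matrix.smul_mulVec, hpow, smul_assoc]

end Exp

/-- For `tr B = 0`, transposition followed by the conjugation with `(0, 1; -1, 0)` maps `B` to
`-B`; it maps `exp B` to the adjugate matrix, and so `exp B` has the determinant `1`. -/
theorem det_exp_of_trace_eq_zero {B : Matrix (Fin 2) (Fin 2) ℝ} (h : B 0 0 + B 1 1 = 0) :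
    (NormedSpace.exp B).det = 1 := by
  set K : Matrix (Fin 2) (Fin 2) ℝ := !![0, 1; -1, 0] with hK
  have hdet : K.det = 1 := by simp [hK]
  have hKu : IsUnit K := (Matrix.isUnit_iff_isUnit_det K).2 (by rw [hdet]; exact isUnit_one)
  have hKi : K⁻¹ = !![0, -1; 1, 0] := by
    apply Matrix.inv_eq_right_inv
    ext i j
    fin_cases i <;> fin_cases j <;> simp [hK]
  have hconj : ∀ M : Matrix (Fin 2) (Fin 2) ℝ,
      K * Mᵀ * K⁻¹ = !![M 1 1, -M 0 1; -M 1 0, M 0 0] := by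
    intro M
    rw [hKi]
    ext i j
    fin_cases i <;> fin_cases j <;>
      simp [hK, Matrix.mul_apply, Matrix.vecMul, dotProduct, Fin.sum_univ_two]
  have h1 : K * Bᵀ * K⁻¹ = -B := by
    have h11 : B 1 1 = -B 0 0 := by linarith
    rw [hconj]
    ext i j
    fin_cases i <;> fin_cases j <;> simp [h11]
  have h2 := Matrix.exp_conj K Bᵀ hKu
  rw [h1, Matrix.exp_transpose, hconj, Matrix.exp_neg] at h2
  have h3 : IsUnit (NormedSpace.exp B).det :=
    (Matrix.isUnit_iff_isUnit_det _).1 (Matrix.isUnit_exp B)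
  have h4 := Matrix.mul_nonsing_inv _ h3
  rw [h2] at h4
  have h5 := congrFun (congrFun h4 0) 0
  simp [Matrix.mul_apply, Fin.sum_univ_two] at h5
  rw [Matrix.det_fin_two]
  linarith

theorem fundamentalField_actH2R (X : Matrix (Fin 3) (Fin 3) ℝ) (p : Vec 3) :
    fundamentalField actH2R X p =
      ![X 0 1 + (X 0 0 - X 1 1) * p 0 - X 1 0 * (p 0 * p 0 - p 1 * p 1),
        (X 0 0 - X 1 1) * p 1 - 2 * X 1 0 * (p 0 * p 1), X 2 2] := by
  apply HasDerivAt.deriv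
  have h := hasDerivAt_exp_entry X
  have hu := ((h 1 0).mul_const (p 0)).fun_add (h 1 1)
  have hv := (h 1 0).mul_const (p 1)
  have hN := (hu.fun_mul hu).fun_add (hv.fun_mul hv)
  have hn := (((h 0 0).mul_const (p 0)).fun_add (h 0 1)).fun_mul hu |>.fun_add
    (((h 0 0).fun_mul (h 1 0)).mul_const (p 1 * p 1))
  have hd := (((h 0 0).fun_mul (h 1 1)).fun_sub ((h 0 1).fun_mul (h 1 0))).mul_const (p 1)
  have hN0 : (NormedSpace.exp ((0 : ℝ) • X) 1 0 * p 0 + NormedSpace.exp ((0 : ℝ) • X) 1 1)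
      * (NormedSpace.exp ((0 : ℝ) • X) 1 0 * p 0 + NormedSpace.exp ((0 : ℝ) • X) 1 1)
      + NormedSpace.exp ((0 : ℝ) • X) 1 0 * p 1 * (NormedSpace.exp ((0 : ℝ) • X) 1 0 * p 1)
      ≠ 0 := by simp
  simp only [actH2R_eq]
  refine hasDerivAt_pi.2 fun i => ?_
  fin_cases i
  · refine (hn.fun_div hN hN0).congr_deriv ?_
    simp
    ring
  · refine (hd.fun_div hN hN0).congr_deriv ?_
    simp
    ring
  · refine (((h 2 2).log (by simp)).const_add (p 2)).congr_deriv ?_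
    simp

theorem fundamentalField_origin (X : Matrix (Fin 3) (Fin 3) ℝ) :
    fundamentalField actH2R X originH2R = ![X 0 1 + X 1 0, X 0 0 - X 1 1, X 2 2] := by
  rw [fundamentalField_actH2R]
  simp [originH2R]

theorem fderiv_fundamentalField (Y : Matrix (Fin 3) (Fin 3) ℝ) (V : Vec 3) :
    fderiv ℝ (fundamentalField actH2R Y) originH2R V =
      ![(Y 0 0 - Y 1 1) * V 0 + 2 * Y 1 0 * V 1, (Y 0 0 - Y 1 1) * V 1 - 2 * Y 1 0 * V 0, 0] := by
  have hX := hasFDerivAt_apply (𝕜 := ℝ) (0 : Fin 3) originH2R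
  have hY := hasFDerivAt_apply (𝕜 := ℝ) (1 : Fin 3) originH2R
  have h0 := ((hX.const_mul (Y 0 0 - Y 1 1)).const_add (Y 0 1)).fun_sub
    (((hX.fun_mul hX).fun_sub (hY.fun_mul hY)).const_mul (Y 1 0))
  have h1 := (hY.const_mul (Y 0 0 - Y 1 1)).fun_sub ((hX.fun_mul hY).const_mul (2 * Y 1 0))
  have h2 := hasFDerivAt_const (𝕜 := ℝ) (Y 2 2) originH2R
  have hd : DifferentiableAt ℝ (fundamentalField actH2R Y) originH2R := by
    rw [funext (fundamentalField_actH2R Y)]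
    refine differentiableAt_pi.2 fun i => ?_
    fin_cases i
    · exact h0.differentiableAt
    · exact h1.differentiableAt
    · exact h2.differentiableAt
  ext i
  rw [fderiv_apply_component hd]
  simp only [fundamentalField_actH2R]
  fin_cases i
  · refine (congrArg (fun L => L V) h0.fderiv).trans ?_
    simp [originH2R]
    ring
  · refine (congrArg (fun L => L V) h1.fderiv).trans ?_
    simp [originH2R]
  · refine (congrArg (fun L => L V) h2.fderiv).trans ?_
    simp

theorem tildeNabla_fundamentalField (S : Tensor12 3) (X Y : Matrix (Fin 3) (Fin 3) ℝ) :
    tildeNabla gH2R S originH2R (fundamentalField actH2R X originH2R) (fundamentalField actH2R Y) =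
      ![-((X 0 0 - X 1 1) * (Y 0 1 - Y 1 0)), (X 0 1 + X 1 0) * (Y 0 1 - Y 1 0), 0]
      - S originH2R ![X 0 1 + X 1 0, X 0 0 - X 1 1, X 2 2]
          ![Y 0 1 + Y 1 0, Y 0 0 - Y 1 1, Y 2 2] := by
  rw [tildeNabla, fderiv_fundamentalField, tildeCoeff, christoffel_gH2R origin_mem,
    ← add_sub_assoc]
  simp only [fundamentalField_origin]
  congr 1
  ext i
  fin_cases i <;> simp [originH2R] <;> ring

/-! ### The two transitive actions -/

theorem exists_GL_eq_blockMatrix {B : Matrix (Fin 2) (Fin 2) ℝ} (hB : B.det ≠ 0) (t : ℝ) :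
    ∃ A : GL (Fin 3) ℝ, (A : Matrix (Fin 3) (Fin 3) ℝ) = blockMatrix B t ∧
      ((A⁻¹ : GL (Fin 3) ℝ) : Matrix (Fin 3) (Fin 3) ℝ) = blockMatrix B⁻¹ (-t) := by
  have hu : IsUnit B.det := isUnit_iff_ne_zero.2 hB
  exact ⟨⟨blockMatrix B t, blockMatrix B⁻¹ (-t),
    by rw [blockMatrix_mul, Matrix.mul_nonsing_inv _ hu, add_neg_cancel, blockMatrix_one],
    by rw [blockMatrix_mul, Matrix.nonsing_inv_mul _ hu, neg_add_cancel, blockMatrix_one]⟩,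
    rfl, rfl⟩

theorem isTransitiveIsometricAction_of_block {G : Subgroup (GL (Fin 3) ℝ)}
    (hG : ∀ A ∈ G, ∃ B t, 0 < B.det ∧ (A : Matrix (Fin 3) (Fin 3) ℝ) = blockMatrix B t)
    (ht : ∀ p ∈ H2R, ∀ q ∈ H2R, ∃ A ∈ G, actH2R A p = q) :
    IsTransitiveIsometricAction H2R gH2R G actH2R where
  one_act p _ := act_one p
  mul_act A hA A' hA' p hp := by
    obtain ⟨B, s, -, h⟩ := hG A hA
    obtain ⟨C, t, hC, h'⟩ := hG A' hA'
    rw [Units.val_mul, h, h', act_blockMatrix_mul B hC s t hp]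
  isometry A hA := by
    obtain ⟨B, s, hB, h⟩ := hG A hA
    rw [h]
    exact act_isometry hB s
  transitive := ht

theorem groupSL2R_block {A : GL (Fin 3) ℝ} (hA : A ∈ groupSL2R) :
    ∃ B t, 0 < B.det ∧ (A : Matrix (Fin 3) (Fin 3) ℝ) = blockMatrix B t := by
  obtain ⟨B, t, h⟩ := hA
  exact ⟨B, t, by rw [B.det_coe]; exact one_pos, h⟩

theorem groupSolvable_block {A : GL (Fin 3) ℝ} (hA : A ∈ groupSolvable) :
    ∃ B t, 0 < B.det ∧ (A : Matrix (Fin 3) (Fin 3) ℝ) = blockMatrix B t := by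
  obtain ⟨x, y, t, hy, h⟩ := hA
  exact ⟨_, t, by simpa [Matrix.det_fin_two] using hy, h⟩

theorem mem_groupSL2R_of_det {A : GL (Fin 3) ℝ} {B : Matrix (Fin 2) (Fin 2) ℝ} {t : ℝ}
    (hB : B.det = 1) (hA : (A : Matrix (Fin 3) (Fin 3) ℝ) = blockMatrix B t) : A ∈ groupSL2R :=
  ⟨⟨B, hB⟩, t, hA⟩

theorem isTransitiveIsometricAction_groupSL2R :
    IsTransitiveIsometricAction H2R gH2R groupSL2R actH2R := by
  refine isTransitiveIsometricAction_of_block (fun A hA => groupSL2R_block hA)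
    fun p hp q hq => ?_
  have hp1 : 0 < p 1 := hp
  have hq1 : 0 < q 1 := hq
  -- the map `w ↦ r² w + x`, with `r² = q₁ / p₁`
  obtain ⟨r, hr, hrs⟩ : ∃ r : ℝ, 0 < r ∧ r * r = q 1 / p 1 :=
    ⟨Real.sqrt (q 1 / p 1), Real.sqrt_pos.2 (div_pos hq1 hp1),
      Real.mul_self_sqrt (div_pos hq1 hp1).le⟩
  set B : Matrix (Fin 2) (Fin 2) ℝ := !![r, (q 0 - r * r * p 0) / r; 0, 1 / r] with hB
  have hdet : B.det = 1 := by
    rw [hB, Matrix.det_fin_two]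
    simp
    field_simp
  obtain ⟨A, hA, -⟩ := exists_GL_eq_blockMatrix (by rw [hdet]; exact one_ne_zero) (q 2 - p 2)
  refine ⟨A, mem_groupSL2R_of_det hdet hA, ?_⟩
  rw [hA, actH2R_blockMatrix, hdet]
  ext i
  fin_cases i
  · simp [hB]
    field_simp
    ring
  · simp [hB]
    rw [← mul_inv, hrs]
    field_simp
  · simp

theorem isTransitiveIsometricAction_groupSolvable :
    IsTransitiveIsometricAction H2R gH2R groupSolvable actH2R := by
  refine isTransitiveIsometricAction_of_block (fun A hA => groupSolvable_block hA)
    fun p hp q hq => ?_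
  have hp1 : 0 < p 1 := hp
  have hq1 : 0 < q 1 := hq
  set B : Matrix (Fin 2) (Fin 2) ℝ := !![q 1 / p 1, q 0 - q 1 / p 1 * p 0; 0, 1] with hB
  have hdet : B.det = q 1 / p 1 := by simp [hB, Matrix.det_fin_two]
  have hpos : 0 < q 1 / p 1 := div_pos hq1 hp1
  obtain ⟨A, hA, -⟩ := exists_GL_eq_blockMatrix (by rw [hdet]; exact hpos.ne') (q 2 - p 2)
  refine ⟨A, ⟨_, _, _, hpos, hA⟩, ?_⟩
  rw [hA, actH2R_blockMatrix, hdet]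
  ext i
  fin_cases i
  · simp [hB]
  · simp [hB]
    field_simp
  · simp

theorem mem_specialOrthogonalGroup_two {B : Matrix (Fin 2) (Fin 2) ℝ} :
    B ∈ Matrix.specialOrthogonalGroup (Fin 2) ℝ ↔
      B 1 1 = B 0 0 ∧ B 1 0 = -B 0 1 ∧ B 0 0 ^ 2 + B 0 1 ^ 2 = 1 := by
  rw [Matrix.mem_specialOrthogonalGroup_iff, Matrix.mem_orthogonalGroup_iff, Matrix.det_fin_two]
  constructor
  · rintro ⟨h, hd⟩
    have h00 := congrFun (congrFun h 0) 0
    have h01 := congrFun (congrFun h 0) 1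
    have h11 := congrFun (congrFun h 1) 1
    simp [Matrix.mul_apply, Fin.sum_univ_two] at h00 h01 h11
    refine ⟨?_, ?_, by rw [← h00]; ring⟩
    · linear_combination B 0 0 * hd - B 1 1 * h00 + B 0 1 * h01
    · linear_combination -B 0 1 * hd - B 1 0 * h00 + B 0 0 * h01
  · rintro ⟨h1, h2, h3⟩
    constructor
    · ext i j
      fin_cases i <;> fin_cases j <;>
        simp [Matrix.mul_apply, Fin.sum_univ_two, h1, h2] <;>
        first | linear_combination h3 | ring
    · rw [h1, h2]
      linear_combination h3

theorem isotropy_groupSL2R :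
    isotropy groupSL2R actH2R originH2R =
      {A : GL (Fin 3) ℝ | ∃ B ∈ Matrix.specialOrthogonalGroup (Fin 2) ℝ,
        (A : Matrix (Fin 3) (Fin 3) ℝ) = blockMatrix B 0} := by
  ext A
  constructor
  · rintro ⟨⟨⟨B, hB⟩, t, hA⟩, ho⟩
    rw [hA] at ho
    change (A : Matrix (Fin 3) (Fin 3) ℝ) = blockMatrix B t at hA
    change actH2R (blockMatrix B t) originH2R = originH2R at ho
    rw [actH2R_blockMatrix, hB] at ho
    have hN := (denom_pos (by rw [hB]; exact one_pos : 0 < B.det) origin_mem).ne'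
    have h0 := congrFun ho 0
    have h1 := congrFun ho 1
    have h2 := congrFun ho 2
    simp [originH2R] at h0 h1 h2 hN
    subst h2
    refine ⟨B, mem_specialOrthogonalGroup_two.2 ?_, hA⟩
    rw [h1] at h0
    simp at h0
    rw [Matrix.det_fin_two] at hB
    have e1 : B 1 1 = B 0 0 := by
      linear_combination -B 1 1 * hB + B 0 0 * h1 - B 1 0 * h0
    have e2 : B 1 0 = -B 0 1 := by
      linear_combination -B 1 0 * hB - B 0 1 * h1 + B 1 1 * h0
    refine ⟨e1, e2, ?_⟩
    rw [e1, e2] at h1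
    linear_combination h1
  · rintro ⟨B, hB, hA⟩
    obtain ⟨h1, h2, h3⟩ := mem_specialOrthogonalGroup_two.1 hB
    have hd : B.det = 1 := (Matrix.mem_specialOrthogonalGroup_iff.1 hB).2
    refine ⟨mem_groupSL2R_of_det hd hA, ?_⟩
    rw [hA, actH2R_blockMatrix, hd]
    have h3' : B 0 0 * B 0 0 + B 0 1 * B 0 1 = 1 := by linear_combination h3
    ext i
    fin_cases i <;> simp [originH2R, h1, h2, h3']
    ring

theorem isotropy_groupSolvable : isotropy groupSolvable actH2R originH2R = {1} := by
  ext A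
  rw [mem_singleton_iff]
  constructor
  · rintro ⟨⟨x, y, t, hy, hA⟩, ho⟩
    rw [hA, actH2R_blockMatrix] at ho
    have h0 := congrFun ho 0
    have h1 := congrFun ho 1
    have h2 := congrFun ho 2
    simp [originH2R, Matrix.det_fin_two] at h0 h1 h2
    apply Units.ext
    rw [hA, h0, h1, h2, Units.val_one, ← blockMatrix_one, Matrix.one_fin_two]
  · rintro rfl
    exact ⟨one_mem _, act_one _⟩

/-- The diagonal entries define a homomorphism to an abelian group, with an abelian kernel. -/
theorem isSolvable_groupSolvable : Group.IsSolvable groupSolvable := by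
  let f : groupSolvable →* ℝ × ℝ :=
    { toFun := fun A => ((A : GL (Fin 3) ℝ).1 0 0, (A : GL (Fin 3) ℝ).1 2 2)
      map_one' := by simp
      map_mul' := by
        rintro ⟨A, x, y, s, hy, h⟩ ⟨A', x', y', t, hy', h'⟩
        change ((A * A' : GL (Fin 3) ℝ).1 0 0, (A * A' : GL (Fin 3) ℝ).1 2 2) = _
        rw [Units.val_mul, h, h', blockMatrix_mul]
        simp [blockMatrix, Real.exp_add] }
  have hk : Group.IsSolvable f.toHomUnits.ker := by
    refine Group.isSolvable_of_comm ?_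
    rintro ⟨⟨A, x, y, s, hy, h⟩, hA⟩ ⟨⟨A', x', y', t, hy', h'⟩, hA'⟩
    have e := congrArg Units.val (MonoidHom.mem_ker.1 hA)
    have e' := congrArg Units.val (MonoidHom.mem_ker.1 hA')
    simp [f, h, h', blockMatrix] at e e'
    apply Subtype.ext
    apply Subtype.ext
    apply Units.ext
    change A.1 * A'.1 = A'.1 * A.1
    rw [h, h', blockMatrix_mul, blockMatrix_mul, e.1, e'.1, e.2, e'.2]
    simp [add_comm]
  exact Group.isSolvable_of_ker_le_range f.toHomUnits.ker.subtype f.toHomUnits (by simp)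

/-! ### The Lie algebras of the groups and of the isotropy group -/

/-- An entry that is constant on the group vanishes on the Lie algebra. -/
theorem entry_eq_zero_of_const {m : ℕ} {G : Set (GL (Fin m) ℝ)} {X : Matrix (Fin m) (Fin m) ℝ}
    (hX : X ∈ matrixLieAlgebra G) {i j : Fin m} {k : ℝ}
    (h : ∀ A ∈ G, (A : Matrix (Fin m) (Fin m) ℝ) i j = k) : X i j = 0 := by
  have hc : (fun t : ℝ => NormedSpace.exp (t • X) i j) = fun _ => k := by
    ext t
    obtain ⟨A, hA, hAt⟩ := hX t
    rw [← hAt, h A hA]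
  have hd := hasDerivAt_exp_entry X i j
  rw [hc] at hd
  exact hd.unique (hasDerivAt_const _ _)

theorem eq_blockSum {X : Matrix (Fin 3) (Fin 3) ℝ} (h02 : X 0 2 = 0) (h12 : X 1 2 = 0)
    (h20 : X 2 0 = 0) (h21 : X 2 1 = 0) :
    X = blockSum !![X 0 0, X 0 1; X 1 0, X 1 1] (X 2 2) := by
  ext i j
  fin_cases i <;> fin_cases j <;> simp [blockSum, h02, h12, h20, h21]

theorem mem_lieAlgebra_groupSL2R {X : Matrix (Fin 3) (Fin 3) ℝ} :
    X ∈ matrixLieAlgebra (groupSL2R : Set (GL (Fin 3) ℝ)) ↔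
      ∃ a b c s, X = blockSum !![a, b; c, -a] s := by
  constructor
  · intro hX
    have h0 : ∀ i j, (∀ B t, blockMatrix B t i j = 0) → X i j = 0 := fun i j h =>
      entry_eq_zero_of_const hX fun A ⟨B, t, hA⟩ => by rw [hA, h]
    have htr : X 0 0 + X 1 1 = 0 := by
      have h := hasDerivAt_exp_entry X
      have hd := ((h 0 0).fun_mul (h 1 1)).fun_sub ((h 0 1).fun_mul (h 1 0))
      have hc : (fun t : ℝ => NormedSpace.exp (t • X) 0 0 * NormedSpace.exp (t • X) 1 1
          - NormedSpace.exp (t • X) 0 1 * NormedSpace.exp (t • X) 1 0) = fun _ => 1 := by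
        ext t
        obtain ⟨A, ⟨⟨B, hB⟩, s, hA⟩, hAt⟩ := hX t
        rw [← hAt, hA]
        simpa [blockMatrix, Matrix.det_fin_two] using hB
      rw [hc] at hd
      simpa using hd.unique (hasDerivAt_const _ _)
    refine ⟨X 0 0, X 0 1, X 1 0, X 2 2, ?_⟩
    rw [← eq_neg_of_add_eq_zero_right htr]
    apply eq_blockSum <;> exact h0 _ _ fun B t => by simp [blockMatrix]
  · rintro ⟨a, b, c, s, rfl⟩ t
    have hdet : (NormedSpace.exp (t • !![a, b; c, -a])).det = 1 :=
      det_exp_of_trace_eq_zero (by simp)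
    obtain ⟨A, hA, -⟩ := exists_GL_eq_blockMatrix (by rw [hdet]; exact one_ne_zero) (t * s)
    exact ⟨A, mem_groupSL2R_of_det hdet hA, by rw [hA, smul_blockSum, exp_blockSum]⟩

theorem mem_lieAlgebra_isotropy {X : Matrix (Fin 3) (Fin 3) ℝ} :
    X ∈ matrixLieAlgebra (isotropy groupSL2R actH2R originH2R) ↔
      ∃ r, X = blockSum !![0, r; -r, 0] 0 := by
  rw [isotropy_groupSL2R]
  constructor
  · intro hX
    have h0 : ∀ i j k, (∀ B, blockMatrix B 0 i j = k) → X i j = 0 := fun i j k h =>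
      entry_eq_zero_of_const (k := k) hX fun A ⟨B, _, hA⟩ => by rw [hA, h]
    have h := hasDerivAt_exp_entry X
    obtain ⟨a, b, c, s, hs⟩ : ∃ a b c s, X = blockSum !![a, b; c, -a] s := by
      refine mem_lieAlgebra_groupSL2R.1 fun t => ?_
      obtain ⟨A, ⟨B, hB, hA⟩, hAt⟩ := hX t
      exact ⟨A, mem_groupSL2R_of_det (Matrix.mem_specialOrthogonalGroup_iff.1 hB).2 hA, hAt⟩
    have h1 : X 1 1 = X 0 0 := by
      have hd := (h 1 1).fun_sub (h 0 0)
      have hc : (fun t : ℝ => NormedSpace.exp (t • X) 1 1 - NormedSpace.exp (t • X) 0 0)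
          = fun _ => 0 := by
        ext t
        obtain ⟨A, ⟨B, hB, hA⟩, hAt⟩ := hX t
        rw [← hAt, hA]
        simp [blockMatrix, (mem_specialOrthogonalGroup_two.1 hB).1]
      rw [hc] at hd
      exact sub_eq_zero.1 (hd.unique (hasDerivAt_const _ _))
    have h2 : X 1 0 = -X 0 1 := by
      have hd := (h 1 0).fun_add (h 0 1)
      have hc : (fun t : ℝ => NormedSpace.exp (t • X) 1 0 + NormedSpace.exp (t • X) 0 1)
          = fun _ => 0 := by
        ext t
        obtain ⟨A, ⟨B, hB, hA⟩, hAt⟩ := hX t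
        rw [← hAt, hA]
        simp [blockMatrix, (mem_specialOrthogonalGroup_two.1 hB).2.1]
      rw [hc] at hd
      exact eq_neg_of_add_eq_zero_left (hd.unique (hasDerivAt_const _ _))
    have h3 : X 2 2 = 0 := h0 2 2 1 fun B => by simp [blockMatrix]
    rw [hs] at h1 h2 h3
    simp [blockSum] at h1 h2 h3
    refine ⟨b, ?_⟩
    obtain rfl : a = 0 := by linarith
    rw [hs, h2, h3, neg_zero]
  · rintro ⟨r, rfl⟩ t
    have hdet : (NormedSpace.exp (t • !![0, r; -r, 0])).det = 1 :=
      det_exp_of_trace_eq_zero (by simp)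
    obtain ⟨A, hA, -⟩ := exists_GL_eq_blockMatrix (by rw [hdet]; exact one_ne_zero) 0
    refine ⟨A, ⟨_, ?_, hA⟩, by rw [hA, smul_blockSum, exp_blockSum, mul_zero]⟩
    rw [Matrix.mem_specialOrthogonalGroup_iff, Matrix.mem_orthogonalGroup_iff]
    refine ⟨?_, hdet⟩
    have ht : (t • !![0, r; -r, 0])ᵀ = -(t • !![0, r; -r, 0] : Matrix (Fin 2) (Fin 2) ℝ) := by
      ext i j
      fin_cases i <;> fin_cases j <;> simp
    rw [← Matrix.exp_transpose, ht, Matrix.exp_neg]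
    exact Matrix.mul_nonsing_inv _ (by rw [hdet]; exact isUnit_one)

theorem mem_lieAlgebra_groupSolvable {X : Matrix (Fin 3) (Fin 3) ℝ} :
    X ∈ matrixLieAlgebra (groupSolvable : Set (GL (Fin 3) ℝ)) ↔
      ∃ a b s, X = blockSum !![a, b; 0, 0] s := by
  constructor
  · intro hX
    have h0 : ∀ i j k, (∀ x y t, blockMatrix !![y, x; 0, 1] t i j = k) → X i j = 0 :=
      fun i j k h => entry_eq_zero_of_const (k := k) hX fun A ⟨x, y, t, _, hA⟩ => by rw [hA, h]
    have h10 : X 1 0 = 0 := h0 1 0 0 fun x y t => by simp [blockMatrix]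
    have h11 : X 1 1 = 0 := h0 1 1 1 fun x y t => by simp [blockMatrix]
    refine ⟨X 0 0, X 0 1, X 2 2, ?_⟩
    have := eq_blockSum (X := X) (h0 _ _ 0 fun x y t => by simp [blockMatrix])
      (h0 _ _ 0 fun x y t => by simp [blockMatrix]) (h0 _ _ 0 fun x y t => by simp [blockMatrix])
      (h0 _ _ 0 fun x y t => by simp [blockMatrix])
    rwa [h10, h11] at this
  · rintro ⟨a, b, s, rfl⟩ t
    -- `(1, 0)` is an eigenvector of the exponent, and `(0, 1)` one of its transpose
    set M : Matrix (Fin 2) (Fin 2) ℝ := t • !![a, b; 0, 0] with hM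
    have hc := exp_mulVec_of_eigenvector (X := M) (v := ![1, 0]) (a := t * a) (by
      ext i
      fin_cases i <;> simp [hM])
    have hr := exp_mulVec_of_eigenvector (X := Mᵀ) (v := ![0, 1]) (a := 0) (by
      ext i
      fin_cases i <;> simp [hM, Matrix.mulVec, dotProduct, Fin.sum_univ_two])
    rw [Matrix.exp_transpose] at hr
    have h00 := congrFun hc 0
    have h10 := congrFun hr 0
    have h11 := congrFun hr 1
    simp [Matrix.mulVec, dotProduct, Fin.sum_univ_two] at h00 h10 h11
    have he : NormedSpace.exp M = !![Real.exp (t * a), NormedSpace.exp M 0 1; 0, 1] := by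
      rw [← h00, ← h10, ← h11]
      exact Matrix.eta_fin_two _
    have hd : (NormedSpace.exp M).det ≠ 0 :=
      ((Matrix.isUnit_iff_isUnit_det _).1 (Matrix.isUnit_exp M)).ne_zero
    obtain ⟨A, hA, -⟩ := exists_GL_eq_blockMatrix hd (t * s)
    exact ⟨A, ⟨_, _, _, Real.exp_pos _, by rw [hA, he]⟩, by rw [hA, smul_blockSum, exp_blockSum]⟩

theorem mem_lieAlgebra_one {m : ℕ} {X : Matrix (Fin m) (Fin m) ℝ} :
    X ∈ matrixLieAlgebra ({1} : Set (GL (Fin m) ℝ)) ↔ X = 0 := by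
  constructor
  · intro hX
    ext i j
    exact entry_eq_zero_of_const (k := (1 : Matrix (Fin m) (Fin m) ℝ) i j) hX fun A hA => by
      rw [mem_singleton_iff.1 hA, Units.val_one]
  · rintro rfl t
    exact ⟨1, rfl, by rw [smul_zero, NormedSpace.exp_zero, Units.val_one]⟩

/-! ### Invariant tensors -/

theorem invariant_tensorFamily (c : ℝ) {B : Matrix (Fin 2) (Fin 2) ℝ} (hB : 0 < B.det) (t : ℝ) :
    Intertwines H2R (actH2R (blockMatrix B t)) (tensorFamily c) (tensorFamily c) := by
  intro p hp X Y
  rw [tensorFamily_apply c hp, tensorFamily_apply c (act_mem hB t hp), map_smul,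
    fderiv_act_hrot hB t hp, fderiv_act_two hB t hp]

theorem invariant_tensorSolvable {x y : ℝ} (hy : 0 < y) (t : ℝ) :
    Intertwines H2R (actH2R (blockMatrix !![y, x; 0, 1] t)) tensorSolvable tensorSolvable := by
  intro p hp X Y
  have hB : 0 < (!![y, x; 0, 1] : Matrix (Fin 2) (Fin 2) ℝ).det := by
    simpa [Matrix.det_fin_two] using hy
  have hp1 : p 1 ≠ 0 := ne_of_gt hp
  rw [tensorSolvable_apply hp, tensorSolvable_apply (act_mem hB t hp), map_smul,
    fderiv_act_hrot hB t hp]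
  congr 1
  rw [fderiv_act hB t hp, actH2R_blockMatrix]
  simp [Matrix.det_fin_two]
  field_simp

theorem Intertwines.congr {φ : Vec 3 → Vec 3} (hφ : MapsTo φ H2R H2R) {S T : Tensor12 3}
    (h : Intertwines H2R φ T T) (hST : EqOn S T H2R) : Intertwines H2R φ S S := by
  intro p hp X Y
  rw [hST hp, hST (hφ hp)]
  exact h p hp X Y

/-- Invariant tensor fields are determined by their values at the origin. -/
theorem eqOn_of_invariant {G : Subgroup (GL (Fin 3) ℝ)}
    (hG : IsTransitiveIsometricAction H2R gH2R G actH2R) {S T : Tensor12 3}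
    (hS : ∀ A ∈ G, Intertwines H2R (actH2R A) S S) (hT : ∀ A ∈ G, Intertwines H2R (actH2R A) T T)
    (h : ∀ X Y, S originH2R X Y = T originH2R X Y) : EqOn S T H2R := by
  intro p hp
  obtain ⟨A, hA, rfl⟩ := hG.transitive _ origin_mem p hp
  refine LinearMap.ext fun X => LinearMap.ext fun Y => ?_
  obtain ⟨X, rfl⟩ := (hG.isometry A hA).fderiv_surjective origin_mem X
  obtain ⟨Y, rfl⟩ := (hG.isometry A hA).fderiv_surjective origin_mem Y
  rw [← hS A hA _ origin_mem, ← hT A hA _ origin_mem, h]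

theorem tensorFamily_origin (c : ℝ) (X Y : Vec 3) :
    tensorFamily c originH2R X Y = (c * X 2) • hrot Y := tensorFamily_apply c origin_mem X Y

theorem tensorSolvable_origin (X Y : Vec 3) :
    tensorSolvable originH2R X Y = X 0 • hrot Y := by
  rw [tensorSolvable_apply origin_mem]
  simp [originH2R]

/-! ### The reductive decompositions of `SL(2,ℝ) × ℝ` -/

/-- The element of the Lie algebra of `SL(2,ℝ) × ℝ` whose fundamental field has the value `u` at
the origin, in the complement of `𝔰𝔬(2)` spanned by the symmetric trace-free matrices and
`∂_z + k (0, 1; -1, 0)`. -/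
noncomputable def liftSL2R (k : ℝ) : Vec 3 →ₗ[ℝ] Matrix (Fin 3) (Fin 3) ℝ where
  toFun u := blockSum !![u 1 / 2, u 0 / 2 + k * u 2; u 0 / 2 - k * u 2, -(u 1 / 2)] (u 2)
  map_add' u v := by
    ext i j
    fin_cases i <;> fin_cases j <;> simp [blockSum] <;> ring
  map_smul' c u := by
    ext i j
    fin_cases i <;> fin_cases j <;> simp [blockSum] <;> ring

theorem liftSL2R_apply (k : ℝ) (u : Vec 3) : liftSL2R k u =
    blockSum !![u 1 / 2, u 0 / 2 + k * u 2; u 0 / 2 - k * u 2, -(u 1 / 2)] (u 2) := rfl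

theorem fundamentalField_liftSL2R (k : ℝ) (u : Vec 3) :
    fundamentalField actH2R (liftSL2R k u) originH2R = u := by
  rw [fundamentalField_origin, liftSL2R_apply]
  ext i
  fin_cases i <;> simp [blockSum]

theorem tildeNabla_liftSL2R (S : Tensor12 3) (k : ℝ) (u v : Vec 3) :
    tildeNabla gH2R S originH2R (fundamentalField actH2R (liftSL2R k u) originH2R)
      (fundamentalField actH2R (liftSL2R k v)) = (2 * k * v 2) • hrot u - S originH2R u v := by
  have h := tildeNabla_fundamentalField S (liftSL2R k u) (liftSL2R k v)
  rw [← fundamentalField_origin (liftSL2R k v), fundamentalField_liftSL2R,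
    ← fundamentalField_origin (liftSL2R k u), fundamentalField_liftSL2R] at h
  rw [fundamentalField_liftSL2R, h, fundamentalField_liftSL2R]
  congr 1
  ext i
  fin_cases i <;> simp [liftSL2R_apply, blockSum, hrot] <;> ring

/-- The component in the range of `liftSL2R k` of a bracket of two of its elements. -/
theorem bracket_liftSL2R (k : ℝ) (u v w : Vec 3) :
    (liftSL2R k u * liftSL2R k v - liftSL2R k v * liftSL2R k u) - liftSL2R k w ∈
      matrixLieAlgebra (isotropy groupSL2R actH2R originH2R) ↔
        w = (2 * k * u 2) • hrot v - (2 * k * v 2) • hrot u := by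
  rw [mem_lieAlgebra_isotropy]
  have hcomm : liftSL2R k u * liftSL2R k v - liftSL2R k v * liftSL2R k u =
      blockSum !![k * (u 2 * v 0 - v 2 * u 0),
          u 1 * (v 0 / 2 + k * v 2) - v 1 * (u 0 / 2 + k * u 2);
        -(u 1 * (v 0 / 2 - k * v 2) - v 1 * (u 0 / 2 - k * u 2)),
          -(k * (u 2 * v 0 - v 2 * u 0))]
        0 := by
    simp only [liftSL2R_apply]
    ext i j
    fin_cases i <;> fin_cases j <;>
      simp [blockSum] <;> ring
  rw [hcomm, liftSL2R_apply]
  constructor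
  · rintro ⟨r, hr⟩
    have h00 := congrFun (congrFun hr 0) 0
    have h01 := congrFun (congrFun hr 0) 1
    have h10 := congrFun (congrFun hr 1) 0
    have h22 := congrFun (congrFun hr 2) 2
    simp [blockSum] at h00 h01 h10 h22
    ext i
    fin_cases i
    · simp [hrot]
      linear_combination -h01 - h10
    · simp [hrot]
      linear_combination -2 * h00
    · simpa [hrot] using h22
  · rintro rfl
    refine ⟨u 1 * v 0 / 2 - v 1 * u 0 / 2, ?_⟩
    ext i j
    fin_cases i <;> fin_cases j <;> simp [blockSum, hrot] <;> ring

theorem ad_blockMatrix_liftSL2R (k : ℝ) {r s : ℝ} (h : r ^ 2 + s ^ 2 = 1) (u : Vec 3) :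
    blockMatrix !![r, s; -s, r] 0 * liftSL2R k u * blockMatrix !![r, -s; s, r] 0 =
      liftSL2R k ![(r ^ 2 - s ^ 2) * u 0 - 2 * r * s * u 1,
        (r ^ 2 - s ^ 2) * u 1 + 2 * r * s * u 0, u 2] := by
  simp only [liftSL2R_apply]
  ext i j
  fin_cases i <;> fin_cases j <;>
    simp [blockSum, blockMatrix]
  · ring
  · linear_combination (k * u 2) * h
  · linear_combination (-k * u 2) * h
  · ring

theorem exists_rotation {A : GL (Fin 3) ℝ} (hA : A ∈ isotropy groupSL2R actH2R originH2R) :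
    ∃ r s : ℝ, r ^ 2 + s ^ 2 = 1 ∧
      (A : Matrix (Fin 3) (Fin 3) ℝ) = blockMatrix !![r, s; -s, r] 0 ∧
      ((A⁻¹ : GL (Fin 3) ℝ) : Matrix (Fin 3) (Fin 3) ℝ) = blockMatrix !![r, -s; s, r] 0 := by
  rw [isotropy_groupSL2R] at hA
  obtain ⟨B, hB, hA⟩ := hA
  obtain ⟨h1, h2, h3⟩ := mem_specialOrthogonalGroup_two.1 hB
  have hBe : B = !![B 0 0, B 0 1; -B 0 1, B 0 0] := by
    conv_lhs => rw [Matrix.eta_fin_two B, h1, h2]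
  rw [hBe] at hA
  refine ⟨B 0 0, B 0 1, h3, hA, ?_⟩
  rw [Units.inv_eq_of_mul_eq_one_right]
  rw [hA, blockMatrix_mul, add_zero, ← blockMatrix_one]
  congr 1
  ext i j
  fin_cases i <;> fin_cases j <;> simp <;> first | linear_combination h3 | ring

theorem isLieSubspace_liftSL2R (k : ℝ) :
    IsLieSubspace groupSL2R actH2R originH2R (LinearMap.range (liftSL2R k)) where
  subset := by
    rintro _ ⟨u, rfl⟩
    exact mem_lieAlgebra_groupSL2R.2 ⟨_, _, _, _, rfl⟩
  span X hX := by
    obtain ⟨a, b, c, s, rfl⟩ := mem_lieAlgebra_groupSL2R.1 hX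
    refine ⟨_, ⟨![b + c, 2 * a, s], rfl⟩,
      mem_lieAlgebra_isotropy.2 ⟨(b - c) / 2 - k * s, ?_⟩⟩
    rw [liftSL2R_apply]
    ext i j
    fin_cases i <;> fin_cases j <;> simp [blockSum] <;> ring
  disjoint := by
    rintro _ ⟨u, rfl⟩ hu
    obtain ⟨r, hr⟩ := mem_lieAlgebra_isotropy.1 hu
    rw [← map_zero (liftSL2R k)]
    congr 1
    rw [← fundamentalField_liftSL2R k u, hr, fundamentalField_origin]
    ext i
    fin_cases i <;> simp [blockSum]
  ad_invariant A hA := by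
    rintro _ ⟨u, rfl⟩
    obtain ⟨r, s, h, hA1, hA2⟩ := exists_rotation hA
    rw [hA1, hA2, ad_blockMatrix_liftSL2R k h]
    exact ⟨_, rfl⟩

/-- Conversely, an invariant complement contains the range of some `liftSL2R k`, because the
rotation by a right angle acts by `-1` on the symmetric trace-free matrices. -/
theorem IsLieSubspace.exists_liftSL2R {𝔪 : Submodule ℝ (Matrix (Fin 3) (Fin 3) ℝ)}
    (h : IsLieSubspace groupSL2R actH2R originH2R 𝔪) : ∃ k, ∀ u, liftSL2R k u ∈ 𝔪 := by
  have hspan : ∀ u, ∃ r, liftSL2R 0 u + blockSum !![0, r; -r, 0] 0 ∈ 𝔪 := by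
    intro u
    obtain ⟨Y, hY, hu⟩ := h.span (liftSL2R 0 u) (mem_lieAlgebra_groupSL2R.2 ⟨_, _, _, _, rfl⟩)
    obtain ⟨r, hr⟩ := mem_lieAlgebra_isotropy.1 hu
    refine ⟨-r, ?_⟩
    have : liftSL2R 0 u + blockSum !![0, -r; - -r, 0] 0 = Y := by
      rw [sub_eq_iff_eq_add] at hr
      rw [hr]
      ext i j
      fin_cases i <;> fin_cases j <;> simp [blockSum]
    rwa [this]
  have hhor : ∀ u : Vec 3, u 2 = 0 → liftSL2R 0 u ∈ 𝔪 := by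
    intro u hu
    obtain ⟨r, hr⟩ := hspan u
    have hK : (!![0, 1; -1, 0] : Matrix (Fin 2) (Fin 2) ℝ) ∈
        Matrix.specialOrthogonalGroup (Fin 2) ℝ := mem_specialOrthogonalGroup_two.2 (by simp)
    obtain ⟨A, hA, hAi⟩ := exists_GL_eq_blockMatrix
      (B := !![0, 1; -1, 0]) (by simp [Matrix.det_fin_two]) 0
    have hinv : (!![0, 1; -1, 0] : Matrix (Fin 2) (Fin 2) ℝ)⁻¹ = !![0, -1; 1, 0] := by
      apply Matrix.inv_eq_right_inv
      ext i j
      fin_cases i <;> fin_cases j <;> simp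
    have hAo : A ∈ isotropy groupSL2R actH2R originH2R := by
      rw [isotropy_groupSL2R]
      exact ⟨_, hK, hA⟩
    have had := h.ad_invariant A hAo _ hr
    rw [hA, hAi, hinv, neg_zero] at had
    have hsub := 𝔪.sub_mem hr had
    have he : liftSL2R 0 u + blockSum !![0, r; -r, 0] 0 - blockMatrix !![0, 1; -1, 0] 0
        * (liftSL2R 0 u + blockSum !![0, r; -r, 0] 0) * blockMatrix !![0, -1; 1, 0] 0
        = (2 : ℝ) • liftSL2R 0 u := by
      simp only [liftSL2R_apply]
      ext i j
      fin_cases i <;> fin_cases j <;>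
        simp [blockSum, blockMatrix, hu] <;> ring
    rw [he] at hsub
    exact (𝔪.smul_mem_iff two_ne_zero).1 hsub
  obtain ⟨k, hk⟩ := hspan (Pi.single 2 1)
  refine ⟨k, fun u => ?_⟩
  have he : liftSL2R k u = liftSL2R 0 ![u 0, u 1, 0]
      + u 2 • (liftSL2R 0 (Pi.single 2 1) + blockSum !![0, k; -k, 0] 0) := by
    simp only [liftSL2R_apply]
    ext i j
    fin_cases i <;> fin_cases j <;> simp [blockSum] <;> ring
  rw [he]
  exact 𝔪.add_mem (hhor _ rfl) (𝔪.smul_mem _ hk)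

theorem arisesFromCosetSpace_groupSL2R (S : Tensor12 3) :
    ArisesFromCosetSpace H2R gH2R groupSL2R actH2R originH2R S ↔
      ∃ c : ℝ, EqOn S (tensorFamily c) H2R := by
  have hinv : ∀ c, ∀ A ∈ groupSL2R,
      Intertwines H2R (actH2R A) (tensorFamily c) (tensorFamily c) := by
    intro c A hA
    obtain ⟨B, t, hB, h⟩ := groupSL2R_block hA
    rw [h]
    exact invariant_tensorFamily c hB t
  constructor
  · rintro ⟨𝔪, h𝔪, hS⟩
    obtain ⟨k, hk⟩ := h𝔪.exists_liftSL2R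
    refine ⟨2 * k, eqOn_of_invariant isTransitiveIsometricAction_groupSL2R hS.invariant
      (hinv _) fun u v => ?_⟩
    have h := hS.at_origin _ (hk u) _ (hk v) _ (hk _) ((bracket_liftSL2R k u v _).2 rfl)
    rw [tildeNabla_liftSL2R, fundamentalField_liftSL2R] at h
    rw [tensorFamily_origin]
    rw [neg_sub] at h
    exact sub_right_injective h
  · rintro ⟨c, hc⟩
    refine ⟨_, isLieSubspace_liftSL2R (c / 2), fun A hA => (hinv c A hA).congr
      (isTransitiveIsometricAction_groupSL2R.isometry A hA).mapsTo hc, ?_⟩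
    rintro _ ⟨u, rfl⟩ _ ⟨v, rfl⟩ _ ⟨w, rfl⟩ hw
    rw [bracket_liftSL2R] at hw
    rw [tildeNabla_liftSL2R, fundamentalField_liftSL2R, hw, hc origin_mem, tensorFamily_origin,
      neg_sub, mul_div_cancel₀ c two_ne_zero]

/-! ### The reductive decomposition of the solvable group -/

/-- The element of the Lie algebra of the solvable group whose fundamental field has the value `u`
at the origin. -/
def liftSolvable : Vec 3 →ₗ[ℝ] Matrix (Fin 3) (Fin 3) ℝ where
  toFun u := blockSum !![u 1, u 0; 0, 0] (u 2)
  map_add' u v := by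
    ext i j
    fin_cases i <;> fin_cases j <;> simp [blockSum]
  map_smul' c u := by
    ext i j
    fin_cases i <;> fin_cases j <;> simp [blockSum]

theorem liftSolvable_apply (u : Vec 3) :
    liftSolvable u = blockSum !![u 1, u 0; 0, 0] (u 2) := rfl

theorem mem_lieAlgebra_groupSolvable_iff {X : Matrix (Fin 3) (Fin 3) ℝ} :
    X ∈ matrixLieAlgebra (groupSolvable : Set (GL (Fin 3) ℝ)) ↔ ∃ u, liftSolvable u = X := by
  rw [mem_lieAlgebra_groupSolvable]
  constructor
  · rintro ⟨a, b, s, rfl⟩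
    exact ⟨![b, a, s], rfl⟩
  · rintro ⟨u, rfl⟩
    exact ⟨_, _, _, rfl⟩

theorem fundamentalField_liftSolvable (u : Vec 3) :
    fundamentalField actH2R (liftSolvable u) originH2R = u := by
  rw [fundamentalField_origin, liftSolvable_apply]
  ext i
  fin_cases i <;> simp [blockSum]

theorem tildeNabla_liftSolvable (S : Tensor12 3) (u v : Vec 3) :
    tildeNabla gH2R S originH2R (fundamentalField actH2R (liftSolvable u) originH2R)
      (fundamentalField actH2R (liftSolvable v))
      = ![-(u 1 * v 0), u 0 * v 0, 0] - S originH2R u v := by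
  have h := tildeNabla_fundamentalField S (liftSolvable u) (liftSolvable v)
  rw [← fundamentalField_origin (liftSolvable v), fundamentalField_liftSolvable,
    ← fundamentalField_origin (liftSolvable u), fundamentalField_liftSolvable] at h
  rw [fundamentalField_liftSolvable, h, fundamentalField_liftSolvable]
  congr 1
  ext i
  fin_cases i <;> simp [liftSolvable_apply, blockSum]

theorem bracket_liftSolvable (u v : Vec 3) :
    liftSolvable u * liftSolvable v - liftSolvable v * liftSolvable u
      = liftSolvable ![u 1 * v 0 - v 1 * u 0, 0, 0] := by
  simp only [liftSolvable_apply]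
  ext i j
  fin_cases i <;> fin_cases j <;> simp [blockSum] <;> ring

theorem arisesFromCosetSpace_groupSolvable (S : Tensor12 3) :
    ArisesFromCosetSpace H2R gH2R groupSolvable actH2R originH2R S ↔
      EqOn S tensorSolvable H2R := by
  have hinv : ∀ A ∈ groupSolvable,
      Intertwines H2R (actH2R A) tensorSolvable tensorSolvable := by
    rintro A ⟨x, y, t, hy, h⟩
    rw [h]
    exact invariant_tensorSolvable hy t
  have key : ∀ u v : Vec 3, ![-(u 1 * v 0), u 0 * v 0, 0] - tensorSolvable originH2R u v
      = -![u 1 * v 0 - v 1 * u 0, 0, 0] := by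
    intro u v
    rw [tensorSolvable_origin]
    ext i
    fin_cases i <;> simp [hrot]
    ring
  constructor
  · rintro ⟨𝔪, h𝔪, hS⟩
    have hm : ∀ u, liftSolvable u ∈ 𝔪 := by
      intro u
      obtain ⟨Y, hY, hu⟩ := h𝔪.span _ (mem_lieAlgebra_groupSolvable_iff.2 ⟨u, rfl⟩)
      rw [isotropy_groupSolvable, mem_lieAlgebra_one, sub_eq_zero] at hu
      rwa [hu]
    refine eqOn_of_invariant isTransitiveIsometricAction_groupSolvable hS.invariant hinv
      fun u v => ?_
    have h := hS.at_origin _ (hm u) _ (hm v) _ (hm ![u 1 * v 0 - v 1 * u 0, 0, 0]) (by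
      rw [isotropy_groupSolvable, mem_lieAlgebra_one, bracket_liftSolvable, sub_self])
    rw [tildeNabla_liftSolvable, fundamentalField_liftSolvable, ← key] at h
    exact sub_right_injective h
  · intro hS
    refine ⟨LinearMap.range liftSolvable, ⟨?_, ?_, ?_, ?_⟩, fun A hA => (hinv A hA).congr
      (isTransitiveIsometricAction_groupSolvable.isometry A hA).mapsTo hS, ?_⟩
    · exact fun X hX => mem_lieAlgebra_groupSolvable_iff.2 hX
    · intro X hX
      refine ⟨X, mem_lieAlgebra_groupSolvable_iff.1 hX, ?_⟩
      rw [isotropy_groupSolvable, mem_lieAlgebra_one, sub_self]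
    · intro X _ hX
      rwa [isotropy_groupSolvable, mem_lieAlgebra_one] at hX
    · intro A hA X hX
      rw [isotropy_groupSolvable, mem_singleton_iff] at hA
      rw [hA, inv_one, Units.val_one, one_mul, mul_one]
      exact hX
    · rintro _ ⟨u, rfl⟩ _ ⟨v, rfl⟩ W _ hW
      rw [isotropy_groupSolvable, mem_lieAlgebra_one, sub_eq_zero, bracket_liftSolvable] at hW
      rw [← hW, tildeNabla_liftSolvable, fundamentalField_liftSolvable, hS origin_mem, key]

theorem theorem2 :
    -- all the tensors of the list are homogeneous structure tensors
    (∀ c : ℝ, 0 ≤ c → IsHomogeneousStructure H2R gH2R (tensorFamily c)) ∧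
    IsHomogeneousStructure H2R gH2R tensorSolvable ∧
    -- every homogeneous structure tensor is isomorphic to one of the list
    (∀ S : Tensor12 3, IsHomogeneousStructure H2R gH2R S →
      (∃ c : ℝ, 0 ≤ c ∧ IsomorphicTensors H2R gH2R S (tensorFamily c)) ∨
        IsomorphicTensors H2R gH2R S tensorSolvable) ∧
    -- no two tensors of the list are isomorphic
    (∀ c d : ℝ, 0 ≤ c → 0 ≤ d →
      IsomorphicTensors H2R gH2R (tensorFamily c) (tensorFamily d) → c = d) ∧
    (∀ c : ℝ, 0 ≤ c → ¬ IsomorphicTensors H2R gH2R (tensorFamily c) tensorSolvable) ∧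
    -- the coset space representation `SL(2,ℝ) × ℝ / SO(2)` and its tensors
    IsTransitiveIsometricAction H2R gH2R groupSL2R actH2R ∧
    isotropy groupSL2R actH2R originH2R =
      {A : GL (Fin 3) ℝ | ∃ B ∈ Matrix.specialOrthogonalGroup (Fin 2) ℝ,
        (A : Matrix (Fin 3) (Fin 3) ℝ) = blockMatrix B 0} ∧
    (∀ S : Tensor12 3, ArisesFromCosetSpace H2R gH2R groupSL2R actH2R originH2R S ↔
      ∃ c : ℝ, Set.EqOn S (tensorFamily c) H2R) ∧
    -- the representation as a solvable Lie group with left-invariant metric, and its tensor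
    Group.IsSolvable groupSolvable ∧
    IsTransitiveIsometricAction H2R gH2R groupSolvable actH2R ∧
    isotropy groupSolvable actH2R originH2R = {1} ∧
    (∀ S : Tensor12 3, ArisesFromCosetSpace H2R gH2R groupSolvable actH2R originH2R S ↔
      Set.EqOn S tensorSolvable H2R) :=
  ⟨fun c _ => isHomogeneousStructure_tensorFamily c, isHomogeneousStructure_tensorSolvable,
    fun _ hS => hS.isomorphic, fun _ _ hc hd h => eq_of_isomorphic_tensorFamily hc hd h,
    fun c _ => not_isomorphic_tensorSolvable c, isTransitiveIsometricAction_groupSL2R,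
    isotropy_groupSL2R, arisesFromCosetSpace_groupSL2R, isSolvable_groupSolvable,
    isTransitiveIsometricAction_groupSolvable, isotropy_groupSolvable,
    arisesFromCosetSpace_groupSolvable⟩
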